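/- All fields are allowed to be non-commutative (division rings). Let $k$ be a field, let $\sigma$ be an automorphism of $k$, and let $\delta$ be a $\sigma$-derivation of $k$, i.e. an additive map $\delta : k \to k$ with $\delta(ab) = \sigma(a)\delta(b) + \delta(a)b$ for all $a, b \in k$. For a field extension $K/k$, an element $x \in K$ is called algebraic over $k$ if the subfield $k(x) \subseteq K$ generated by $k$ and $x$ has finite dimension both as a left and as a right vector space over $k$. The extension $K/k$ is called regular if every element of $K$ that is algebraic over $k$ belongs to $k$. Then each of the following fields, with $k$ embedded as the constants, is a regular extension of $k$: 1. the skew Laurent series field $k((t,\sigma))$, whose elements are the formal series $\sum_{i \ge n} s_i t^i$ with $n \in \mathbb{Z}$ and left-hand coefficients $s_i \in k$, with multiplication determined by $t a = \sigma(a) t$ for $a \in k$; 2. the skew series field $k_{\sigma,\delta}((z))$, whose elements are the formal series $\sum_{i \ge n} z^i s_i$ with $n \in \mathbb{Z}$ and right-hand coefficients $s_i \in k$, with multiplication determined by $a z = \sum_{i \ge 1} z^i \sigma(\delta^{i-1}(a))$ for $a \in k$; 3. the skew rational fraction field $k(t,\sigma,\delta)$, i.e. the field of fractions of the Ore domain $k[t,\sigma,\delta]$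 of polynomials $\sum_i a_i t^i$ with left-hand coefficients $a_i \in k$, with multiplication determined by $t a = \sigma(a) t + \delta(a)$ for $a \in k$. -/

import Mathlib

/-! ## Extensions of (skew) fields -/

section Extensions

variable {k K : Type*} [DivisionRing k] [DivisionRing K]

/-- The subfield `k(x)` of `K` generated by `x` over (the image of) `k`. -/
def adjoinElem (i : k →+* K) (x : K) : Subfield K :=
  Subfield.closure (Set.range i ∪ {x})

/-- The inclusion of `k` into the subfield `k(x)` of `K`. -/
def toAdjoinElem (i : k →+* K) (x : K) : k →+* adjoinElem i x :=
  i.codRestrict (adjoinElem i x) fun a => Subfield.subset_closure (Or.inl ⟨a, rfl⟩)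

/-- `K` has finite dimension as a left vector space over `k`, for `a • y = i a * y`. -/
def LeftFinite (i : k →+* K) : Prop :=
  letI : Module k K := Module.compHom K i
  Module.Finite k K

/-- `K` has finite dimension as a right vector space over `k`, for `y • a = y * i a`
(right vector spaces over `k` are modules over the opposite ring). -/
def RightFinite (i : k →+* K) : Prop :=
  letI : Module kᵐᵒᵖ K := Module.compHom K i.op
  Module.Finite kᵐᵒᵖ K

/-- An element `x` of a field extension `K/k` is algebraic over `k` if `k(x)` has finite dimension
both as a left and as a right vector space over `k`. -/
def IsAlgebraicElem (i : k →+* K) (x : K) : Prop :=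
  LeftFinite (toAdjoinElem i x) ∧ RightFinite (toAdjoinElem i x)

/-- The field extension `K/k` (given by the homomorphism `i : k → K`) is regular if every element
of `K` which is algebraic over `k` lies in `k`. -/
def IsRegularExtension (i : k →+* K) : Prop :=
  ∀ x : K, IsAlgebraicElem i x → x ∈ Set.range i

end Extensions

/-! ## Laurent series with coefficients in a ring of operators -/

noncomputable section

namespace LaurentOperators

variable {k : Type*} [DivisionRing k]

/-- The action of Laurent series with coefficients in `End(k, +)` on Laurent series with
coefficients in `k`: the coefficient of index `n` of `app Φ x` is `∑_{i+j=n} Φ_i (x_j)`. -/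
def app (Φ : HahnSeries ℤ (AddMonoid.End k)) (x : HahnSeries ℤ k) : HahnSeries ℤ k :=
  (HahnModule.of (AddMonoid.End k)).symm (Φ • HahnModule.of (AddMonoid.End k) x)

theorem app_add (Φ : HahnSeries ℤ (AddMonoid.End k)) (x y : HahnSeries ℤ k) :
    app Φ (x + y) = app Φ x + app Φ y := by
  simp only [app, HahnModule.of_add, smul_add]; rfl

theorem add_app (Φ Ψ : HahnSeries ℤ (AddMonoid.End k)) (x : HahnSeries ℤ k) :
    app (Φ + Ψ) x = app Φ x + app Ψ x := by
  simp only [app, add_smul]; rfl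

theorem mul_app (Φ Ψ : HahnSeries ℤ (AddMonoid.End k)) (x : HahnSeries ℤ k) :
    app (Φ * Ψ) x = app Φ (app Ψ x) := by
  simp only [app, mul_smul]; rfl

theorem one_app (x : HahnSeries ℤ k) : app 1 x = x := by
  simp only [app, one_smul]; rfl

theorem single_app_coeff (i : ℤ) (f : AddMonoid.End k) (x : HahnSeries ℤ k) (n : ℤ) :
    (app (HahnSeries.single i f) x).coeff n = f (x.coeff (n - i)) := by
  have h := HahnModule.coeff_single_smul_vadd (r := f) (a := n - i) (b := i)
    (x := HahnModule.of (AddMonoid.End k) x)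
  rw [vadd_eq_add, add_sub_cancel] at h
  exact h

/-- `x` has no coefficient of index less than `a`. -/
def Above {R : Type*} [Zero R] (x : HahnSeries ℤ R) (a : ℤ) : Prop := ∀ n < a, x.coeff n = 0

theorem exists_above {R : Type*} [Zero R] (x : HahnSeries ℤ R) : ∃ a, Above x a := by
  obtain rfl | hx := eq_or_ne x 0
  · exact ⟨0, fun _ _ => rfl⟩
  · exact ⟨x.order, fun n hn => HahnSeries.coeff_eq_zero_of_lt_order hn⟩

theorem app_coeff {Φ : HahnSeries ℤ (AddMonoid.End k)} {x : HahnSeries ℤ k} {a b : ℤ}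
    (hΦ : Above Φ a) (hx : Above x b) (n : ℤ) :
    (app Φ x).coeff n = ∑ i ∈ Finset.Icc a (n - b), Φ.coeff i (x.coeff (n - i)) := by
  refine (HahnModule.coeff_smul _ _ _).trans ?_
  refine Finset.sum_bij_ne_zero (fun ij _ _ => ij.1) ?_ ?_ ?_ ?_
  · rintro ⟨i, j⟩ h h0
    simp only [Finset.mem_vaddAntidiagonal, vadd_eq_add] at h
    have h1 : ¬ i < a := fun h' => h.1 (hΦ i h')
    have h2 : ¬ j < b := fun h' => h.2.1 (hx j h')
    simp only [Finset.mem_Icc]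
    omega
  · rintro ⟨i, j⟩ h h0 ⟨i', j'⟩ h' h0' heq
    simp only [Finset.mem_vaddAntidiagonal, vadd_eq_add] at h h' heq
    ext <;> simp only <;> omega
  · intro i hi h0
    have h1 : x.coeff (n - i) ≠ 0 := fun h => h0 (by rw [h, map_zero])
    have h2 : Φ.coeff i ≠ 0 := fun h => h0 (by rw [h]; rfl)
    refine ⟨(i, n - i), ?_, ?_, rfl⟩
    · simp only [Finset.mem_vaddAntidiagonal, vadd_eq_add]
      exact ⟨h2, h1, by omega⟩
    · exact h0
  · rintro ⟨i, j⟩ h h0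
    simp only [Finset.mem_vaddAntidiagonal, vadd_eq_add] at h
    obtain rfl : j = n - i := by omega
    rfl

theorem mul_coeff {R : Type*} [Ring R] {Φ x : HahnSeries ℤ R} {a b : ℤ}
    (hΦ : Above Φ a) (hx : Above x b) (n : ℤ) :
    (Φ * x).coeff n = ∑ i ∈ Finset.Icc a (n - b), Φ.coeff i * x.coeff (n - i) := by
  rw [← HahnSeries.of_symm_smul_of_eq_mul]
  refine (HahnModule.coeff_smul _ _ _).trans ?_
  refine Finset.sum_bij_ne_zero (fun ij _ _ => ij.1) ?_ ?_ ?_ ?_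
  · rintro ⟨i, j⟩ h h0
    simp only [Finset.mem_vaddAntidiagonal, vadd_eq_add] at h
    have h1 : ¬ i < a := fun h' => h.1 (hΦ i h')
    have h2 : ¬ j < b := fun h' => h.2.1 (hx j h')
    simp only [Finset.mem_Icc]
    omega
  · rintro ⟨i, j⟩ h h0 ⟨i', j'⟩ h' h0' heq
    simp only [Finset.mem_vaddAntidiagonal, vadd_eq_add] at h h' heq
    ext <;> simp only <;> omega
  · intro i hi h0
    have h1 : x.coeff (n - i) ≠ 0 := fun h => h0 (by rw [h, mul_zero])
    have h2 : Φ.coeff i ≠ 0 := fun h => h0 (by rw [h, zero_mul])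
    refine ⟨(i, n - i), ?_, ?_, rfl⟩
    · simp only [Finset.mem_vaddAntidiagonal, vadd_eq_add]
      exact ⟨h2, h1, by omega⟩
    · exact h0
  · rintro ⟨i, j⟩ h h0
    simp only [Finset.mem_vaddAntidiagonal, vadd_eq_add] at h
    obtain rfl : j = n - i := by omega
    rfl

theorem above_single {R : Type*} [Zero R] (i : ℤ) (r : R) :
    Above (HahnSeries.single i r) i :=
  fun _ hn => HahnSeries.coeff_single_of_ne hn.ne

theorem app_single_zero_coeff (Φ : HahnSeries ℤ (AddMonoid.End k)) (a : k) (n : ℤ) :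
    (app Φ (HahnSeries.single 0 a)).coeff n = Φ.coeff n a := by
  obtain ⟨c, hc⟩ := exists_above Φ
  rw [app_coeff hc (above_single 0 a)]
  by_cases h : c ≤ n
  · rw [Finset.sum_eq_single n]
    · simp
    · intro i _ hi
      rw [HahnSeries.coeff_single_of_ne (by omega), map_zero]
    · intro h'
      exact absurd (by simp [h]) h'
  · rw [hc n (by omega), Finset.Icc_eq_empty (by omega)]; rfl

theorem Above.mul {R : Type*} [Ring R] {x y : HahnSeries ℤ R} {a b : ℤ}
    (hx : Above x a) (hy : Above y b) : Above (x * y) (a + b) := by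
  intro n hn
  rw [mul_coeff hx hy, Finset.Icc_eq_empty (by omega), Finset.sum_empty]

theorem Above.coeff_mul {R : Type*} [Ring R] {x y : HahnSeries ℤ R} {a b : ℤ}
    (hx : Above x a) (hy : Above y b) : (x * y).coeff (a + b) = x.coeff a * y.coeff b := by
  rw [mul_coeff hx hy, add_sub_cancel_right, Finset.Icc_self, Finset.sum_singleton,
    add_sub_cancel_left]

theorem Above.app {Φ : HahnSeries ℤ (AddMonoid.End k)} {x : HahnSeries ℤ k} {a b : ℤ}
    (hx : Above Φ a) (hy : Above x b) : Above (app Φ x) (a + b) := by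
  intro n hn
  rw [app_coeff hx hy, Finset.Icc_eq_empty (by omega), Finset.sum_empty]

theorem app_zero (Φ : HahnSeries ℤ (AddMonoid.End k)) : app Φ 0 = 0 := by
  simp only [app, HahnModule.of_zero, smul_zero]; rfl

theorem zero_app (x : HahnSeries ℤ k) : app 0 x = 0 := by
  simp only [app, zero_smul]; rfl

/-- A Laurent series whose lowest coefficient is a unit is a unit. -/
theorem Above.isUnit {R : Type*} [Ring R] {x : HahnSeries ℤ R} {a : ℤ}
    (hx : Above x a) (hu : IsUnit (x.coeff a)) : IsUnit x := by
  have key : x = HahnSeries.single a 1 *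
      HahnSeries.ofPowerSeries ℤ R (PowerSeries.mk fun n => x.coeff (a + n)) := by
    ext n
    rw [HahnSeries.coeff_single_mul, one_mul]
    by_cases h : n < a
    · rw [hx n h, HahnSeries.ofPowerSeries_apply, HahnSeries.embDomain_of_notMem_range]
      rintro ⟨m, hm⟩
      have hm' : (m : ℤ) = n - a := hm
      omega
    · obtain ⟨m, rfl⟩ : ∃ m : ℕ, n = a + m := ⟨(n - a).toNat, by omega⟩
      rw [add_sub_cancel_left, HahnSeries.ofPowerSeries_apply_coeff, PowerSeries.coeff_mk]
  rw [key]
  refine IsUnit.mul ?_ (IsUnit.map _ ?_)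
  · refine ⟨⟨HahnSeries.single a 1, HahnSeries.single (-a) 1, ?_, ?_⟩, rfl⟩ <;>
    simp [HahnSeries.single_mul_single]
  · obtain ⟨u, hu⟩ := hu
    refine ⟨⟨_, PowerSeries.invOfUnit (PowerSeries.mk fun n => x.coeff (a + n)) u,
      PowerSeries.mul_invOfUnit _ _ ?_, PowerSeries.invOfUnit_mul _ _ ?_⟩, rfl⟩ <;>
    simp [← PowerSeries.coeff_zero_eq_constantCoeff_apply, hu]

/-- Left multiplication by `a` on `k`. -/
def lmul (a : k) : AddMonoid.End k := AddMonoidHom.mulLeft a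

/-- Right multiplication by `a` on `k`. -/
def rmul (a : k) : AddMonoid.End k := AddMonoidHom.mulRight a

theorem lmul_apply (a x : k) : lmul a x = a * x := rfl

theorem rmul_apply (a x : k) : rmul a x = x * a := rfl

theorem isUnit_lmul {a : k} (ha : a ≠ 0) : IsUnit (lmul a) := by
  refine ⟨⟨lmul a, lmul a⁻¹, ?_, ?_⟩, rfl⟩ <;> ext x <;> simp [lmul_apply, ha]

theorem isUnit_rmul {a : k} (ha : a ≠ 0) : IsUnit (rmul a) := by
  refine ⟨⟨rmul a, rmul a⁻¹, ?_, ?_⟩, rfl⟩ <;> ext x <;> simp [rmul_apply, ha]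

/-- An automorphism `σ` of `k`, as a unit of the ring `End(k, +)`. -/
def autUnit (σ : k ≃+* k) : (AddMonoid.End k)ˣ where
  val := (σ : k ≃+ k).toAddMonoidHom
  inv := (σ.symm : k ≃+ k).toAddMonoidHom
  val_inv := by ext x; exact σ.apply_symm_apply x
  inv_val := by ext x; exact σ.symm_apply_apply x

theorem autUnit_apply (σ : k ≃+* k) (x : k) : (autUnit σ : AddMonoid.End k) x = σ x := rfl

theorem autUnit_inv_apply (σ : k ≃+* k) (x : k) :
    ((autUnit σ)⁻¹ : (AddMonoid.End k)ˣ).val x = σ.symm x := rfl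

theorem autUnit_zpow_apply (σ : k ≃+* k) (n : ℤ) (x : k) :
    ((autUnit σ ^ n : (AddMonoid.End k)ˣ) : AddMonoid.End k) x = (σ ^ n) x := by
  induction n using Int.induction_on generalizing x with
  | zero => rfl
  | succ n ih =>
    rw [zpow_add_one, zpow_add_one]
    exact ih (σ x)
  | pred n ih =>
    rw [zpow_sub_one, zpow_sub_one]
    exact ih (σ.symm x)

end LaurentOperators

/-! ## The skew Laurent series field `k((t,σ))` -/

/-- The underlying set of `k((t,σ))`: formal series `∑_{i ≥ n} s_i t^i`, `n ∈ ℤ`, with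
left-hand coefficients `s_i` in `k`. -/
@[ext] structure SkewLaurentSeries {k : Type*} [DivisionRing k] (σ : k ≃+* k) where
  /-- The coefficients `s_i`, as a function `ℤ → k` whose support is bounded below. -/
  toSeries : HahnSeries ℤ k

namespace SkewLaurentSeries

open LaurentOperators

variable {k : Type*} [DivisionRing k] {σ : k ≃+* k}

/-- The left multiplication by `S = ∑ s_i t^i`: as `t^i x = σ^i(x) t^i`, it is given by the Laurent
series of operators with coefficients `x ↦ s_i σ^i(x)`. -/
def leftMul (S : SkewLaurentSeries σ) : HahnSeries ℤ (AddMonoid.End k) where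
  coeff i := lmul (S.toSeries.coeff i) * (autUnit σ ^ i : (AddMonoid.End k)ˣ)
  isPWO_support' := by
    refine S.toSeries.isPWO_support.mono fun i hi h => hi ?_
    have h' : S.toSeries.coeff i = 0 := h
    ext x
    simp only [h']
    exact zero_mul _

instance : Zero (SkewLaurentSeries σ) := ⟨⟨0⟩⟩
instance : One (SkewLaurentSeries σ) := ⟨⟨HahnSeries.single 0 1⟩⟩
instance : Add (SkewLaurentSeries σ) := ⟨fun S T => ⟨S.toSeries + T.toSeries⟩⟩
instance : Neg (SkewLaurentSeries σ) := ⟨fun S => ⟨-S.toSeries⟩⟩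

/-- The product: the coefficient of `t^n` in `S * T` is `∑_{i+j=n} s_i σ^i(t_j)`
(see `SkewLaurentSeries.coeff_mul`). -/
instance : Mul (SkewLaurentSeries σ) := ⟨fun S T => ⟨app (leftMul S) T.toSeries⟩⟩

theorem leftMul_coeff_apply (S : SkewLaurentSeries σ) (i : ℤ) (x : k) :
    (leftMul S).coeff i x = S.toSeries.coeff i * (σ ^ i) x := by
  rw [← autUnit_zpow_apply]; rfl

theorem above_leftMul {S : SkewLaurentSeries σ} {a : ℤ} (h : Above S.toSeries a) :
    Above (leftMul S) a := by
  intro n hn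
  ext x
  rw [leftMul_coeff_apply, h n hn, zero_mul]; rfl

theorem coeff_mul (S T : SkewLaurentSeries σ) {a b : ℤ} (hS : Above S.toSeries a)
    (hT : Above T.toSeries b) (n : ℤ) :
    (S * T).toSeries.coeff n = ∑ i ∈ Finset.Icc a (n - b),
      S.toSeries.coeff i * (σ ^ i) (T.toSeries.coeff (n - i)) := by
  refine (app_coeff (above_leftMul hS) hT n).trans (Finset.sum_congr rfl fun i _ => ?_)
  exact leftMul_coeff_apply _ _ _

theorem leftMul_add (S T : SkewLaurentSeries σ) : leftMul (S + T) = leftMul S + leftMul T := by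
  refine HahnSeries.ext (funext fun n => ?_)
  ext x
  refine (leftMul_coeff_apply _ _ _).trans (Eq.trans ?_ (congrArg₂ (· + ·)
    (leftMul_coeff_apply S n x) (leftMul_coeff_apply T n x)).symm)
  exact add_mul _ _ _

theorem leftMul_one : leftMul (1 : SkewLaurentSeries σ) = 1 := by
  refine HahnSeries.ext (funext fun n => ?_)
  ext x
  rw [leftMul_coeff_apply]
  change (HahnSeries.single (0 : ℤ) (1 : k)).coeff n * _ = _
  by_cases hn : n = 0
  · subst hn
    rw [HahnSeries.coeff_single_same, HahnSeries.coeff_one, if_pos rfl, one_mul, zpow_zero]; rfl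
  · rw [HahnSeries.coeff_single_of_ne hn, HahnSeries.coeff_one, if_neg hn, zero_mul]; rfl

theorem leftMul_mul (S T : SkewLaurentSeries σ) : leftMul (S * T) = leftMul S * leftMul T := by
  obtain ⟨a, ha⟩ := exists_above S.toSeries
  obtain ⟨b, hb⟩ := exists_above T.toSeries
  refine HahnSeries.ext (funext fun n => ?_)
  ext x
  rw [leftMul_coeff_apply, coeff_mul S T ha hb, mul_coeff (above_leftMul ha) (above_leftMul hb),
    Finset.sum_mul]
  refine Eq.trans ?_ (AddMonoidHom.finsetSum_apply _ _ _).symm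
  refine Finset.sum_congr rfl fun i _ => ?_
  refine Eq.trans ?_ (leftMul_coeff_apply S i ((leftMul T).coeff (n - i) x)).symm
  rw [leftMul_coeff_apply, map_mul, ← mul_assoc]
  congr 1
  rw [← RingAut.mul_apply, ← zpow_add, add_sub_cancel]

instance : Ring (SkewLaurentSeries σ) :=
  Ring.ofMinimalAxioms
    (fun _ _ _ => SkewLaurentSeries.ext (add_assoc _ _ _))
    (fun _ => SkewLaurentSeries.ext (zero_add _))
    (fun _ => SkewLaurentSeries.ext (neg_add_cancel _))
    (fun S T U => SkewLaurentSeries.ext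
      ((congrArg (app · U.toSeries) (leftMul_mul S T)).trans (mul_app _ _ _)))
    (fun S => SkewLaurentSeries.ext
      ((congrArg (app · S.toSeries) leftMul_one).trans (one_app _)))
    (fun S => SkewLaurentSeries.ext (HahnSeries.ext (funext fun n =>
      (app_single_zero_coeff _ _ _).trans (by rw [leftMul_coeff_apply, map_one, mul_one]))))
    (fun _ _ _ => SkewLaurentSeries.ext (app_add _ _ _))
    (fun S T U => SkewLaurentSeries.ext
      ((congrArg (app · U.toSeries) (leftMul_add S T)).trans (add_app _ _ _)))

theorem exists_mul_eq_one (S : SkewLaurentSeries σ) (hS : S ≠ 0) : ∃ T, S * T = 1 := by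
  have h0 : S.toSeries ≠ 0 := fun h => hS (SkewLaurentSeries.ext h)
  have hu : IsUnit (leftMul S) :=
    Above.isUnit (above_leftMul fun n hn => HahnSeries.coeff_eq_zero_of_lt_order hn)
      (IsUnit.mul (isUnit_lmul (mt HahnSeries.coeff_order_eq_zero.mp h0)) (Units.isUnit _))
  obtain ⟨u, hu⟩ := hu
  refine ⟨⟨app u⁻¹.val (HahnSeries.single 0 1)⟩, SkewLaurentSeries.ext ?_⟩
  change app (leftMul S) _ = _
  rw [← hu, ← mul_app, Units.mul_inv]
  exact one_app _

instance : Nontrivial (SkewLaurentSeries σ) := ⟨⟨0, 1, fun h => by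
  have h1 := congrArg (fun S => S.toSeries.coeff 0) h
  exact zero_ne_one (h1.trans (HahnSeries.coeff_single_same (0 : ℤ) (1 : k)))⟩⟩

open Classical in
instance : DivisionRing (SkewLaurentSeries σ) where
  inv S := if h : S = 0 then 0 else (exists_mul_eq_one S h).choose
  mul_inv_cancel S h := by
    change S * (if h : S = 0 then 0 else (exists_mul_eq_one S h).choose) = 1
    rw [dif_neg h]
    exact (exists_mul_eq_one S h).choose_spec
  inv_zero := dif_pos rfl
  nnqsmul := _
  nnqsmul_def := fun _ _ => rfl
  qsmul := _
  qsmul_def := fun _ _ => rfl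

/-- The inclusion of `k` into `k((t,σ))` as the constant series. -/
def const (σ : k ≃+* k) : k →+* SkewLaurentSeries σ where
  toFun a := ⟨HahnSeries.single 0 a⟩
  map_one' := rfl
  map_zero' := SkewLaurentSeries.ext HahnSeries.single_eq_zero
  map_add' a b := SkewLaurentSeries.ext (map_add (HahnSeries.single.addMonoidHom (0 : ℤ)) a b)
  map_mul' a b := by
    refine SkewLaurentSeries.ext (HahnSeries.ext (funext fun n => ?_))
    refine Eq.trans ?_ (app_single_zero_coeff (leftMul ⟨HahnSeries.single 0 a⟩) b n).symm
    rw [leftMul_coeff_apply]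
    by_cases hn : n = 0
    · subst hn
      simp
    · simp [HahnSeries.coeff_single_of_ne hn]

end SkewLaurentSeries

/-! ## Skew derivations -/

/-- A `σ`-derivation of `k`: an additive map `δ` with `δ(ab) = σ(a)δ(b) + δ(a)b`. -/
structure SkewDerivation {k : Type*} [DivisionRing k] (σ : k ≃+* k) extends k →+ k where
  leibniz' : ∀ a b, toFun (a * b) = σ a * toFun b + toFun a * b

namespace SkewDerivation

variable {k : Type*} [DivisionRing k] {σ : k ≃+* k}

/-- The underlying additive endomorphism of `k`. -/
def toEnd (δ : SkewDerivation σ) : AddMonoid.End k := δ.toAddMonoidHom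

theorem leibniz (δ : SkewDerivation σ) (a b : k) :
    δ.toEnd (a * b) = σ a * δ.toEnd b + δ.toEnd a * b := δ.leibniz' a b

end SkewDerivation

/-! ## The skew series field `k_{σ,δ}((z))` -/

/-- The underlying set of `k_{σ,δ}((z))`: formal series `∑_{i ≥ n} z^i s_i`, `n ∈ ℤ`, with
right-hand coefficients `s_i` in `k`. -/
@[ext] structure SkewSeries {k : Type*} [DivisionRing k] {σ : k ≃+* k}
    (δ : SkewDerivation σ) where
  /-- The coefficients `s_i`, as a function `ℤ → k` whose support is bounded below. -/
  toSeries : HahnSeries ℤ k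

namespace SkewSeries

open LaurentOperators

variable {k : Type*} [DivisionRing k] {σ : k ≃+* k} {δ : SkewDerivation σ}

/-- The commutation relation `a z = ∑_{i ≥ 1} z^i σ(δ^{i-1}(a))`, as a Laurent series of operators:
its coefficient of index `i` is `σ ∘ δ^{i-1}` for `i ≥ 1`, and `0` for `i < 1`. -/
def zOp (δ : SkewDerivation σ) : HahnSeries ℤ (AddMonoid.End k) where
  coeff i := if 1 ≤ i then (autUnit σ : AddMonoid.End k) * δ.toEnd ^ (i - 1).toNat else 0
  isPWO_support' := by
    have h : BddBelow (Function.support fun i : ℤ =>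
        if 1 ≤ i then (autUnit σ : AddMonoid.End k) * δ.toEnd ^ (i - 1).toNat else 0) := by
      refine ⟨1, fun i hi => ?_⟩
      by_contra h
      exact hi (if_neg h)
    exact h.isWF.isPWO

/-- The operator `a ↦ -δ(σ⁻¹(a))`. -/
def negDelta (δ : SkewDerivation σ) : AddMonoid.End k :=
  lmul (-1) * (δ.toEnd * (autUnit σ)⁻¹.val)

theorem negDelta_apply (a : k) : negDelta δ a = -δ.toEnd (σ.symm a) := neg_one_mul _

/-- The relation `a z⁻¹ = z⁻¹ σ⁻¹(a) - δ(σ⁻¹(a))`, as a Laurent series of operators. -/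
def zInvOp (δ : SkewDerivation σ) : HahnSeries ℤ (AddMonoid.End k) :=
  HahnSeries.single (-1) (autUnit σ)⁻¹.val + HahnSeries.single 0 (negDelta δ)

theorem zOp_coeff (i : ℤ) : (zOp δ).coeff i =
    if 1 ≤ i then (autUnit σ : AddMonoid.End k) * δ.toEnd ^ (i - 1).toNat else 0 := rfl

theorem zInvOp_mul_coeff (Φ : HahnSeries ℤ (AddMonoid.End k)) (n : ℤ) :
    (zInvOp δ * Φ).coeff n = (autUnit σ)⁻¹.val * Φ.coeff (n + 1) +
      negDelta δ * Φ.coeff n := by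
  rw [zInvOp, add_mul, HahnSeries.coeff_add, HahnSeries.coeff_single_mul,
    HahnSeries.coeff_single_mul, sub_neg_eq_add, sub_zero]

theorem zOp_mul_zInvOp : zOp δ * zInvOp δ = 1 := by
  refine HahnSeries.ext (funext fun n => ?_)
  rw [zInvOp, mul_add, HahnSeries.coeff_add, HahnSeries.coeff_mul_single,
    HahnSeries.coeff_mul_single, sub_neg_eq_add, sub_zero, zOp_coeff, zOp_coeff,
    HahnSeries.coeff_one]
  obtain h | rfl | h := lt_trichotomy n 0
  · rw [if_neg (by omega), if_neg (by omega), if_neg (by omega)]; simp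
  · simp
  · obtain ⟨m, rfl⟩ : ∃ m : ℕ, n = m + 1 := ⟨(n - 1).toNat, by omega⟩
    rw [if_pos (by omega), if_pos (by omega), if_neg (by omega),
      show ((m : ℤ) + 1 + 1 - 1).toNat = m + 1 by omega, show ((m : ℤ) + 1 - 1).toNat = m by omega,
      pow_succ]
    ext x
    change σ ((δ.toEnd ^ m) (δ.toEnd (σ.symm x))) + σ ((δ.toEnd ^ m) (negDelta δ x)) = 0
    rw [negDelta_apply, map_neg, map_neg, add_neg_cancel]

theorem zInvOp_mul_zOp : zInvOp δ * zOp δ = 1 := by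
  refine HahnSeries.ext (funext fun n => ?_)
  rw [zInvOp_mul_coeff, zOp_coeff, zOp_coeff, HahnSeries.coeff_one]
  obtain h | rfl | h := lt_trichotomy n 0
  · rw [if_neg (by omega), if_neg (by omega), if_neg (by omega)]; simp
  · simp
  · obtain ⟨m, rfl⟩ : ∃ m : ℕ, n = m + 1 := ⟨(n - 1).toNat, by omega⟩
    rw [if_pos (by omega), if_pos (by omega), if_neg (by omega),
      show ((m : ℤ) + 1 + 1 - 1).toNat = m + 1 by omega, show ((m : ℤ) + 1 - 1).toNat = m by omega,
      pow_succ']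
    ext x
    change σ.symm (σ (δ.toEnd ((δ.toEnd ^ m) x))) + negDelta δ (σ ((δ.toEnd ^ m) x)) = 0
    rw [negDelta_apply, σ.symm_apply_apply, σ.symm_apply_apply, add_neg_cancel]

/-- `zOp δ` as a unit. The relation `a z^j = ∑_n z^n c_{j,n}(a)` which follows from
`a z = ∑_{i ≥ 1} z^i σ(δ^{i-1}(a))` is given by the coefficients `c_{j,n}` of `zUnit δ ^ j`. -/
def zUnit (δ : SkewDerivation σ) : (HahnSeries ℤ (AddMonoid.End k))ˣ where
  val := zOp δ
  inv := zInvOp δ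
  val_inv := zOp_mul_zInvOp
  inv_val := zInvOp_mul_zOp

/-- The operator `c_{j,n}` in the relation `a z^j = ∑_n z^n c_{j,n}(a)`. -/
def zCoeff (δ : SkewDerivation σ) (j n : ℤ) : AddMonoid.End k :=
  (zUnit δ ^ j).val.coeff n

theorem zUnit_zpow_lead (j : ℤ) : Above (zUnit δ ^ j).val j ∧
    (zUnit δ ^ j).val.coeff j = (autUnit σ ^ j).val := by
  have h1 : Above (zOp δ) 1 := fun n hn => if_neg (by omega)
  have h2 : Above (zInvOp δ) (-1) := fun n hn => by
    rw [zInvOp, HahnSeries.coeff_add, HahnSeries.coeff_single_of_ne (by omega),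
      HahnSeries.coeff_single_of_ne (by omega), add_zero]
  have h1' : (zOp δ).coeff 1 = (autUnit σ).val := by
    rw [zOp_coeff, if_pos le_rfl, sub_self, Int.toNat_zero, pow_zero, mul_one]
  have h2' : (zInvOp δ).coeff (-1) = (autUnit σ)⁻¹.val := by
    rw [zInvOp, HahnSeries.coeff_add, HahnSeries.coeff_single_same,
      HahnSeries.coeff_single_of_ne (by omega), add_zero]
  induction j using Int.induction_on with
  | zero =>
    rw [zpow_zero, zpow_zero]
    exact ⟨above_single 0 1, HahnSeries.coeff_single_same 0 1⟩
  | succ n ih =>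
    rw [zpow_add_one, zpow_add_one, Units.val_mul, Units.val_mul]
    exact ⟨ih.1.mul h1, (ih.1.coeff_mul h1).trans (congrArg₂ (· * ·) ih.2 h1')⟩
  | pred n ih =>
    rw [zpow_sub_one, zpow_sub_one, Units.val_mul, Units.val_mul]
    exact ⟨ih.1.mul h2, (ih.1.coeff_mul h2).trans (congrArg₂ (· * ·) ih.2 h2')⟩

theorem zCoeff_of_lt {j n : ℤ} (h : n < j) : zCoeff δ j n = 0 := (zUnit_zpow_lead j).1 n h

theorem zCoeff_self (j : ℤ) : zCoeff δ j j = (autUnit σ ^ j).val := (zUnit_zpow_lead j).2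

theorem zCoeff_sub_one (j n : ℤ) : zCoeff δ (j - 1) n =
    (autUnit σ)⁻¹.val * zCoeff δ j (n + 1) + negDelta δ * zCoeff δ j n := by
  have h : zUnit δ ^ (j - 1) = (zUnit δ)⁻¹ * zUnit δ ^ j := by
    rw [sub_eq_neg_add, zpow_add, zpow_neg_one]
  rw [zCoeff, h]
  exact zInvOp_mul_coeff _ _

/-- The family `j ↦ (x ↦ c_{j,n}(x) t_j)` has finite support. -/
theorem finite_support_term (x : HahnSeries ℤ k) (n : ℤ) :
    (Function.support fun j => rmul (x.coeff j) * zCoeff δ j n).Finite := by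
  obtain ⟨a, ha⟩ := exists_above x
  refine (Set.finite_Icc a n).subset fun j hj => ?_
  by_contra h
  refine hj ?_
  rw [Set.mem_Icc, not_and_or] at h
  obtain h | h := h
  · ext y
    have h0 := ha j (not_le.mp h)
    simp only [h0]
    exact mul_zero _
  · simp only [zCoeff_of_lt (δ := δ) (not_le.mp h), mul_zero]

theorem finsum_term_of_lt {x : HahnSeries ℤ k} {a n : ℤ} (ha : Above x a) (hn : n < a) :
    ∑ᶠ j : ℤ, rmul (x.coeff j) * zCoeff δ j n = 0 := by
  refine finsum_eq_zero_of_forall_eq_zero fun j => ?_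
  by_cases h : j < a
  · ext y
    rw [ha j h]
    exact mul_zero _
  · rw [zCoeff_of_lt (by omega), mul_zero]

/-- The right multiplication by `T = ∑ z^j t_j`: as `x T = ∑_j (x z^j) t_j = ∑_n z^n ∑_j c_{j,n}(x) t_j`
for `x` in `k`, it is given by the Laurent series of operators with coefficients
`x ↦ ∑_j c_{j,n}(x) t_j` (a finite sum). -/
def rightMul (T : SkewSeries δ) : HahnSeries ℤ (AddMonoid.End k) where
  coeff n := ∑ᶠ j : ℤ, rmul (T.toSeries.coeff j) * zCoeff δ j n
  isPWO_support' := by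
    have h : BddBelow (Function.support fun n : ℤ =>
        ∑ᶠ j : ℤ, rmul (T.toSeries.coeff j) * zCoeff δ j n) := by
      obtain ⟨a, ha⟩ := exists_above T.toSeries
      refine ⟨a, fun n hn => ?_⟩
      by_contra h
      exact hn (finsum_term_of_lt ha (not_le.mp h))
    exact h.isWF.isPWO

instance : Zero (SkewSeries δ) := ⟨⟨0⟩⟩
instance : One (SkewSeries δ) := ⟨⟨HahnSeries.single 0 1⟩⟩
instance : Add (SkewSeries δ) := ⟨fun S T => ⟨S.toSeries + T.toSeries⟩⟩
instance : Neg (SkewSeries δ) := ⟨fun S => ⟨-S.toSeries⟩⟩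

/-- The product: the coefficient of `z^n` in `S * T` is `∑_{i+m=n} ∑_j c_{j,m}(s_i) t_j`, that is,
`S * T = ∑_{i,j} z^i (s_i z^j) t_j` (see `SkewSeries.coeff_mul`). -/
instance : Mul (SkewSeries δ) := ⟨fun S T => ⟨app (rightMul T) S.toSeries⟩⟩

theorem rightMul_coeff {T : SkewSeries δ} {a : ℤ} (ha : Above T.toSeries a) (n : ℤ) :
    (rightMul T).coeff n = ∑ j ∈ Finset.Icc a n, rmul (T.toSeries.coeff j) * zCoeff δ j n := by
  refine finsum_eq_finsetSum_of_support_subset _ fun j hj => ?_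
  by_contra h
  refine hj ?_
  rw [Finset.coe_Icc, Set.mem_Icc, not_and_or] at h
  obtain h | h := h
  · ext y
    have h0 := ha j (not_le.mp h)
    simp only [h0]
    exact mul_zero _
  · simp only [zCoeff_of_lt (δ := δ) (not_le.mp h), mul_zero]

theorem above_rightMul {T : SkewSeries δ} {a : ℤ} (h : Above T.toSeries a) :
    Above (rightMul T) a :=
  fun _ hn => finsum_term_of_lt h hn

theorem rightMul_coeff_self {T : SkewSeries δ} {a : ℤ} (h : Above T.toSeries a) :
    (rightMul T).coeff a = rmul (T.toSeries.coeff a) * (autUnit σ ^ a).val := by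
  rw [rightMul_coeff h, Finset.Icc_self, Finset.sum_singleton, zCoeff_self]

theorem app_zInvOp_coeff (x : HahnSeries ℤ k) (n : ℤ) : (app (zInvOp δ) x).coeff n =
    σ.symm (x.coeff (n + 1)) + negDelta δ (x.coeff n) := by
  rw [zInvOp, add_app, HahnSeries.coeff_add, single_app_coeff, single_app_coeff, sub_neg_eq_add,
    sub_zero]
  rfl

theorem app_zOp_zInvOp (x : HahnSeries ℤ k) : app (zOp δ) (app (zInvOp δ) x) = x := by
  rw [← mul_app, zOp_mul_zInvOp, one_app]

theorem app_zInvOp_zOp (x : HahnSeries ℤ k) : app (zInvOp δ) (app (zOp δ) x) = x := by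
  rw [← mul_app, zInvOp_mul_zOp, one_app]

theorem toEnd_one : δ.toEnd 1 = 0 := by
  have h := δ.leibniz 1 1
  rwa [mul_one, mul_one, map_one σ, one_mul, left_eq_add] at h

theorem app_zInvOp_single (m : ℤ) : app (zInvOp δ) (HahnSeries.single m (1 : k)) =
    HahnSeries.single (m - 1) 1 := by
  refine HahnSeries.ext (funext fun n => ?_)
  rw [app_zInvOp_coeff, HahnSeries.coeff_single, HahnSeries.coeff_single, HahnSeries.coeff_single]
  have h0 : ∀ c : k, c = 0 ∨ c = 1 → negDelta δ c = 0 := by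
    rintro c (rfl | rfl)
    · rw [map_zero]
    · rw [negDelta_apply, map_one, toEnd_one, neg_zero]
  rw [h0, add_zero]
  swap
  · split_ifs
    · exact Or.inr rfl
    · exact Or.inl rfl
  by_cases h : n + 1 = m
  · rw [if_pos h, if_pos (by omega), map_one]
  · rw [if_neg h, if_neg (by omega), map_zero]

theorem app_zUnit_zpow_single (j : ℤ) : app (zUnit δ ^ j).val (HahnSeries.single 0 (1 : k)) =
    HahnSeries.single j 1 := by
  induction j using Int.induction_on with
  | zero => rw [zpow_zero]; exact one_app _
  | succ n ih =>
    rw [add_comm, zpow_add, zpow_one, Units.val_mul, mul_app, ih]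
    have h := app_zInvOp_single (δ := δ) (1 + n)
    rw [add_sub_cancel_left] at h
    rw [← h]
    exact app_zOp_zInvOp _
  | pred n ih =>
    rw [sub_eq_neg_add, zpow_add, zpow_neg_one, Units.val_mul, mul_app, ih, ← sub_eq_neg_add]
    exact app_zInvOp_single _

theorem zCoeff_one (j n : ℤ) : zCoeff δ j n 1 = if n = j then 1 else 0 := by
  rw [zCoeff, ← app_single_zero_coeff, app_zUnit_zpow_single, HahnSeries.coeff_single]
  split_ifs <;> rfl

theorem rightMul_coeff_one (T : SkewSeries δ) (n : ℤ) :
    (rightMul T).coeff n 1 = T.toSeries.coeff n := by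
  obtain ⟨a, ha⟩ := exists_above T.toSeries
  rw [rightMul_coeff ha]
  refine (AddMonoidHom.finsetSum_apply _ _ _).trans ?_
  have h : ∀ j, (rmul (T.toSeries.coeff j) * zCoeff δ j n) 1 =
      if n = j then T.toSeries.coeff j else 0 := by
    intro j
    refine (congrArg (· * T.toSeries.coeff j) (zCoeff_one j n)).trans ?_
    simp only [ite_mul, one_mul, zero_mul]
  refine (Finset.sum_congr rfl fun j _ => h j).trans ?_
  rw [Finset.sum_ite_eq]
  split_ifs with h
  · rfl
  · rw [Finset.mem_Icc] at h
    exact (ha n (by omega)).symm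

theorem coeff_mul (S T : SkewSeries δ) {a b : ℤ} (hS : Above S.toSeries a)
    (hT : Above T.toSeries b) (n : ℤ) :
    (S * T).toSeries.coeff n = ∑ m ∈ Finset.Icc b (n - a), ∑ j ∈ Finset.Icc b m,
      zCoeff δ j m (S.toSeries.coeff (n - m)) * T.toSeries.coeff j := by
  refine (app_coeff (above_rightMul hT) hS n).trans (Finset.sum_congr rfl fun m _ => ?_)
  rw [rightMul_coeff hT]
  exact AddMonoidHom.finsetSum_apply _ _ _

theorem rightMul_add (S T : SkewSeries δ) : rightMul (S + T) = rightMul S + rightMul T := by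
  refine HahnSeries.ext (funext fun n => ?_)
  refine Eq.trans ?_ (finsum_add_distrib (finite_support_term (δ := δ) S.toSeries n)
    (finite_support_term (δ := δ) T.toSeries n))
  refine finsum_congr fun j => ?_
  ext x
  exact mul_add _ _ _

theorem negDelta_rmul (t : k) : negDelta δ * rmul t =
    rmul (σ.symm t) * negDelta δ + rmul (negDelta δ t) := by
  ext x
  change negDelta δ (x * t) = negDelta δ x * σ.symm t + x * negDelta δ t
  rw [negDelta_apply, negDelta_apply, negDelta_apply, map_mul, SkewDerivation.leibniz,
    σ.apply_symm_apply, neg_add_rev, neg_mul, mul_neg]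

theorem inv_rmul (t : k) : (autUnit σ)⁻¹.val * rmul t =
    rmul (σ.symm t) * (autUnit σ)⁻¹.val := by
  ext x
  exact map_mul σ.symm x t

theorem rmul_add (s t : k) : rmul (s + t) = rmul s + rmul t := by
  ext x
  exact mul_add x s t

/-- `(S T) z⁻¹ = S (T z⁻¹)`, as operators on `S`. -/
theorem zInvOp_mul_rightMul (x : HahnSeries ℤ k) :
    zInvOp δ * rightMul (δ := δ) ⟨x⟩ = rightMul (δ := δ) ⟨app (zInvOp δ) x⟩ := by
  refine HahnSeries.ext (funext fun n => ?_)
  rw [zInvOp_mul_coeff]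
  obtain ⟨a, ha⟩ := exists_above x
  have ha' : Above (app (zInvOp δ) x) (a - 1) := by
    intro n hn
    rw [app_zInvOp_coeff, ha _ (by omega), ha _ (by omega)]
    simp
  rw [rightMul_coeff (T := ⟨app (zInvOp δ) x⟩) ha', rightMul_coeff (T := ⟨x⟩) ha,
    rightMul_coeff (T := ⟨x⟩) ha]
  have e1 : ∑ j ∈ Finset.Icc a n, rmul (x.coeff j) * zCoeff δ j n =
      ∑ j ∈ Finset.Icc a (n + 1), rmul (x.coeff j) * zCoeff δ j n := by
    refine Finset.sum_subset (Finset.Icc_subset_Icc le_rfl (by omega)) fun j _ hj => ?_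
    rw [Finset.mem_Icc] at *
    rw [zCoeff_of_lt (by omega), mul_zero]
  have e2 : ∑ j ∈ Finset.Icc (a - 1) n, rmul ((app (zInvOp δ) x).coeff j) * zCoeff δ j n =
      ∑ j ∈ Finset.Icc a (n + 1), rmul (σ.symm (x.coeff j)) * zCoeff δ (j - 1) n +
      ∑ j ∈ Finset.Icc a (n + 1), rmul (negDelta δ (x.coeff j)) * zCoeff δ j n := by
    have e3 : ∑ j ∈ Finset.Icc a (n + 1), rmul (σ.symm (x.coeff j)) * zCoeff δ (j - 1) n =
        ∑ j ∈ Finset.Icc (a - 1) n, rmul (σ.symm (x.coeff (j + 1))) * zCoeff δ j n := by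
      refine Finset.sum_bij' (fun j _ => j - 1) (fun j _ => j + 1) ?_ ?_ ?_ ?_ ?_
      · intro j hj; rw [Finset.mem_Icc] at *; omega
      · intro j hj; rw [Finset.mem_Icc] at *; omega
      · intro j _; omega
      · intro j _; omega
      · intro j _; rw [sub_add_cancel]
    have e4 : ∑ j ∈ Finset.Icc a (n + 1), rmul (negDelta δ (x.coeff j)) * zCoeff δ j n =
        ∑ j ∈ Finset.Icc (a - 1) n, rmul (negDelta δ (x.coeff j)) * zCoeff δ j n := by
      refine (Finset.sum_subset (Finset.Icc_subset_Icc (by omega) le_rfl) fun j _ hj => ?_).trans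
        (Finset.sum_subset (Finset.Icc_subset_Icc (le_rfl : a - 1 ≤ a - 1) (by omega : n ≤ n + 1))
          fun j _ hj => ?_).symm
      · rw [Finset.mem_Icc] at *
        rw [ha j (by omega), map_zero]
        ext y
        exact mul_zero _
      · rw [Finset.mem_Icc] at *
        rw [zCoeff_of_lt (by omega), mul_zero]
    rw [e3, e4, ← Finset.sum_add_distrib]
    refine Finset.sum_congr rfl fun j _ => ?_
    rw [app_zInvOp_coeff, rmul_add, add_mul]
  rw [e1, e2, Finset.mul_sum, Finset.mul_sum, ← Finset.sum_add_distrib, ← Finset.sum_add_distrib]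
  refine Finset.sum_congr rfl fun j _ => ?_
  rw [zCoeff_sub_one, ← mul_assoc _ (rmul _), ← mul_assoc _ (rmul _), negDelta_rmul, inv_rmul]
  simp only [mul_add, add_mul, mul_assoc]
  abel

theorem zOp_mul_rightMul (x : HahnSeries ℤ k) :
    zOp δ * rightMul (δ := δ) ⟨x⟩ = rightMul (δ := δ) ⟨app (zOp δ) x⟩ := by
  have h := zInvOp_mul_rightMul (δ := δ) (app (zOp δ) x)
  rw [app_zInvOp_zOp] at h
  rw [← h, ← mul_assoc, zOp_mul_zInvOp, one_mul]

theorem zUnit_zpow_mul_rightMul (j : ℤ) (x : HahnSeries ℤ k) :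
    (zUnit δ ^ j).val * rightMul (δ := δ) ⟨x⟩ = rightMul (δ := δ) ⟨app (zUnit δ ^ j).val x⟩ := by
  induction j using Int.induction_on generalizing x with
  | zero => rw [zpow_zero, Units.val_one, one_mul, one_app]
  | succ n ih =>
    rw [zpow_add_one, Units.val_mul, mul_assoc, mul_app, ← ih]
    exact congrArg _ (zOp_mul_rightMul x)
  | pred n ih =>
    rw [zpow_sub_one, Units.val_mul, mul_assoc, mul_app, ← ih]
    exact congrArg _ (zInvOp_mul_rightMul x)

theorem rightMul_zero : rightMul (0 : SkewSeries δ) = 0 := by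
  refine HahnSeries.ext (funext fun n => finsum_eq_zero_of_forall_eq_zero fun j => ?_)
  ext x
  exact mul_zero _

theorem rightMul_single (j : ℤ) (u : k) : rightMul (δ := δ) ⟨HahnSeries.single j u⟩ =
    HahnSeries.single 0 (rmul u) * (zUnit δ ^ j).val := by
  refine HahnSeries.ext (funext fun n => ?_)
  rw [HahnSeries.coeff_single_mul, sub_zero]
  refine (finsum_eq_single _ j fun i hi => ?_).trans ?_
  · simp only [HahnSeries.coeff_single_of_ne hi]
    ext x
    exact mul_zero _
  · simp only [HahnSeries.coeff_single_same]; rfl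

theorem rightMul_one : rightMul (1 : SkewSeries δ) = 1 := by
  refine (rightMul_single 0 1).trans ?_
  rw [zpow_zero, Units.val_one, mul_one]
  have h : rmul (1 : k) = 1 := by ext x; exact mul_one x
  rw [h]; rfl

theorem single_mul_rightMul (u : k) (x : HahnSeries ℤ k) :
    HahnSeries.single 0 (rmul u) * rightMul (δ := δ) ⟨x⟩ =
      rightMul (δ := δ) ⟨app (HahnSeries.single 0 (rmul u)) x⟩ := by
  obtain ⟨a, ha⟩ := exists_above x
  have ha' : Above (app (HahnSeries.single 0 (rmul u)) x) a := by
    have := (above_single 0 (rmul u)).app ha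
    rwa [zero_add] at this
  refine HahnSeries.ext (funext fun n => ?_)
  rw [HahnSeries.coeff_single_mul, sub_zero, rightMul_coeff (T := ⟨x⟩) ha,
    rightMul_coeff (T := ⟨app (HahnSeries.single 0 (rmul u)) x⟩) ha', Finset.mul_sum]
  refine Finset.sum_congr rfl fun j _ => ?_
  rw [single_app_coeff, sub_zero]
  ext y
  exact mul_assoc _ _ _

theorem rightMul_single_mul (j : ℤ) (u : k) (T : SkewSeries δ) :
    rightMul (δ := δ) ⟨HahnSeries.single j u⟩ * rightMul T =
      rightMul (T * ⟨HahnSeries.single j u⟩) := by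
  rw [rightMul_single, mul_assoc]
  refine (congrArg _ (zUnit_zpow_mul_rightMul j T.toSeries)).trans ?_
  rw [single_mul_rightMul, ← mul_app, ← rightMul_single]
  rfl

theorem mul_def (S T : SkewSeries δ) : S * T = ⟨app (rightMul T) S.toSeries⟩ := rfl

theorem rightMul_sum_single_mul (U : HahnSeries ℤ k) (s : Finset ℤ) (T : SkewSeries δ) :
    rightMul (δ := δ) ⟨∑ j ∈ s, HahnSeries.single j (U.coeff j)⟩ * rightMul T =
      rightMul (T * ⟨∑ j ∈ s, HahnSeries.single j (U.coeff j)⟩) := by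
  classical
  induction s using Finset.induction_on with
  | empty =>
    have h0 : T * (0 : SkewSeries δ) = 0 := by
      rw [mul_def, rightMul_zero, zero_app]; rfl
    change rightMul (0 : SkewSeries δ) * _ = rightMul (T * (0 : SkewSeries δ))
    rw [h0, rightMul_zero, zero_mul]
  | insert j s hj ih =>
    rw [Finset.sum_insert hj]
    have h1 : ∀ x y : HahnSeries ℤ k, (⟨x + y⟩ : SkewSeries δ) = ⟨x⟩ + ⟨y⟩ := fun _ _ => rfl
    have h2 : ∀ x y : SkewSeries δ, T * (x + y) = T * x + T * y := fun x y => by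
      rw [mul_def, rightMul_add, add_app]; rfl
    rw [h1, h2, rightMul_add, rightMul_add, add_mul, ih, rightMul_single_mul]

theorem rightMul_mul (T U : SkewSeries δ) : rightMul (T * U) = rightMul U * rightMul T := by
  obtain ⟨a, ha⟩ := exists_above T.toSeries
  obtain ⟨b, hb⟩ := exists_above U.toSeries
  refine HahnSeries.ext (funext fun n => ?_)
  set P : SkewSeries δ :=
    ⟨∑ j ∈ Finset.Icc b (n - a), HahnSeries.single j (U.toSeries.coeff j)⟩ with hP
  set V : SkewSeries δ := ⟨U.toSeries - P.toSeries⟩ with hV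
  have hUPV : U = P + V := SkewSeries.ext (add_sub_cancel _ _).symm
  have hVa : Above V.toSeries (n - a + 1) := by
    intro m hm
    change (U.toSeries - ∑ j ∈ Finset.Icc b (n - a),
      HahnSeries.single j (U.toSeries.coeff j)).coeff m = 0
    rw [HahnSeries.coeff_sub, HahnSeries.coeff_sum]
    simp only [HahnSeries.coeff_single]
    have h := Finset.sum_ite_eq (Finset.Icc b (n - a)) m fun x => U.toSeries.coeff x
    by_cases hm' : b ≤ m
    · rw [if_pos (Finset.mem_Icc.mpr ⟨hm', by omega⟩)] at h
      rw [sub_eq_zero]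
      exact (Eq.trans (Finset.sum_congr rfl fun _ _ => by congr) h).symm
    · rw [if_neg fun h' => hm' (Finset.mem_Icc.mp h').1] at h
      rw [hb m (by omega), zero_sub, neg_eq_zero]
      exact (Finset.sum_congr rfl fun _ _ => by congr).trans h
  have h2 : ∀ x y : SkewSeries δ, T * (x + y) = T * x + T * y := fun x y => by
    rw [mul_def, rightMul_add, add_app]; rfl
  have hPP : rightMul P * rightMul T = rightMul (T * P) := rightMul_sum_single_mul _ _ _
  rw [hUPV, h2, rightMul_add, rightMul_add, add_mul, HahnSeries.coeff_add, HahnSeries.coeff_add,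
    hPP]
  have hTV : Above (T * V).toSeries (n - a + 1 + a) := (above_rightMul hVa).app ha
  rw [above_rightMul hTV n (by omega),
    ((above_rightMul hVa).mul (above_rightMul ha)) n (by omega)]

instance : Ring (SkewSeries δ) :=
  Ring.ofMinimalAxioms
    (fun _ _ _ => SkewSeries.ext (add_assoc _ _ _))
    (fun _ => SkewSeries.ext (zero_add _))
    (fun _ => SkewSeries.ext (neg_add_cancel _))
    (fun S T U => SkewSeries.ext
      ((congrArg (app · S.toSeries) (rightMul_mul T U)).trans (mul_app _ _ _)).symm)
    (fun S => SkewSeries.ext (HahnSeries.ext (funext fun n =>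
      (app_single_zero_coeff _ _ _).trans (rightMul_coeff_one S n))))
    (fun S => SkewSeries.ext
      ((congrArg (app · S.toSeries) rightMul_one).trans (one_app _)))
    (fun S T U => SkewSeries.ext
      ((congrArg (app · S.toSeries) (rightMul_add T U)).trans (add_app _ _ _)))
    (fun _ _ _ => SkewSeries.ext (app_add _ _ _))

theorem exists_mul_eq_one' (S : SkewSeries δ) (hS : S ≠ 0) : ∃ T, T * S = 1 := by
  have h0 : S.toSeries ≠ 0 := fun h => hS (SkewSeries.ext h)
  have ha : Above S.toSeries S.toSeries.order :=
    fun n hn => HahnSeries.coeff_eq_zero_of_lt_order hn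
  have hu : IsUnit (rightMul S) := by
    refine Above.isUnit (above_rightMul ha) ?_
    rw [rightMul_coeff_self ha]
    exact IsUnit.mul (isUnit_rmul (mt HahnSeries.coeff_order_eq_zero.mp h0)) (Units.isUnit _)
  obtain ⟨u, hu⟩ := hu
  refine ⟨⟨app u⁻¹.val (HahnSeries.single 0 1)⟩, SkewSeries.ext ?_⟩
  change app (rightMul S) _ = _
  rw [← hu, ← mul_app, Units.mul_inv]
  exact one_app _

instance : Nontrivial (SkewSeries δ) := ⟨⟨0, 1, fun h => by
  have h1 := congrArg (fun S => S.toSeries.coeff 0) h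
  exact zero_ne_one (h1.trans (HahnSeries.coeff_single_same (0 : ℤ) (1 : k)))⟩⟩

theorem exists_mul_eq_one (S : SkewSeries δ) (hS : S ≠ 0) : ∃ T, S * T = 1 := by
  obtain ⟨T, hT⟩ := exists_mul_eq_one' S hS
  have hT0 : T ≠ 0 := by
    rintro rfl
    rw [zero_mul] at hT
    exact zero_ne_one hT
  obtain ⟨U, hU⟩ := exists_mul_eq_one' T hT0
  refine ⟨T, ?_⟩
  have : U = S := by rw [← mul_one U, ← hT, ← mul_assoc, hU, one_mul]
  rwa [this] at hU

open Classical in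
instance : DivisionRing (SkewSeries δ) where
  inv S := if h : S = 0 then 0 else (exists_mul_eq_one S h).choose
  mul_inv_cancel S h := by
    change S * (if h : S = 0 then 0 else (exists_mul_eq_one S h).choose) = 1
    rw [dif_neg h]
    exact (exists_mul_eq_one S h).choose_spec
  inv_zero := dif_pos rfl
  nnqsmul := _
  nnqsmul_def := fun _ _ => rfl
  qsmul := _
  qsmul_def := fun _ _ => rfl

/-- The inclusion of `k` into `k_{σ,δ}((z))` as the constant series. -/
def const (δ : SkewDerivation σ) : k →+* SkewSeries δ where
  toFun a := ⟨HahnSeries.single 0 a⟩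
  map_one' := rfl
  map_zero' := SkewSeries.ext HahnSeries.single_eq_zero
  map_add' a b := SkewSeries.ext (map_add (HahnSeries.single.addMonoidHom (0 : ℤ)) a b)
  map_mul' a b := by
    refine SkewSeries.ext (HahnSeries.ext (funext fun n => ?_))
    change _ = (app (rightMul (δ := δ) ⟨HahnSeries.single 0 b⟩) (HahnSeries.single 0 a)).coeff n
    rw [app_single_zero_coeff, rightMul_single, zpow_zero, Units.val_one, mul_one]
    by_cases hn : n = 0
    · subst hn
      rw [HahnSeries.coeff_single_same, HahnSeries.coeff_single_same]; rfl
    · rw [HahnSeries.coeff_single_of_ne hn, HahnSeries.coeff_single_of_ne hn]; rfl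

/-- The element `z`. -/
def z (δ : SkewDerivation σ) : SkewSeries δ := ⟨HahnSeries.single 1 1⟩

/-- The relation `a z = ∑_{i ≥ 1} z^i σ(δ^{i-1}(a))`. -/
theorem coeff_const_mul_z (a : k) (i : ℤ) : (const δ a * z δ).toSeries.coeff i =
    if 1 ≤ i then σ ((δ.toEnd ^ (i - 1).toNat) a) else 0 := by
  change (app (rightMul (δ := δ) ⟨HahnSeries.single 1 1⟩) (HahnSeries.single 0 a)).coeff i = _
  rw [app_single_zero_coeff, rightMul_single, HahnSeries.coeff_single_mul, sub_zero, zpow_one]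
  refine (mul_one _).trans ?_
  change (zOp δ).coeff i a = _
  rw [zOp_coeff]
  split_ifs <;> rfl

end SkewSeries

/-! ## The skew polynomial ring `k[t,σ,δ]` and its field of fractions `k(t,σ,δ)` -/

/-- The underlying set of `k[t,σ,δ]`: polynomials `∑ a_i t^i` with left-hand coefficients `a_i`
in `k`. -/
@[ext] structure OrePolynomial {k : Type*} [DivisionRing k] {σ : k ≃+* k}
    (δ : SkewDerivation σ) where
  /-- The coefficients `a_i`. -/
  toFinsupp : ℕ →₀ k

namespace OrePolynomial

variable {k : Type*} [DivisionRing k] {σ : k ≃+* k} {δ : SkewDerivation σ}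

/-- Left multiplication by a constant: `∑ b_j t^j ↦ ∑ a b_j t^j`. -/
def smulOp (a : k) : AddMonoid.End (ℕ →₀ k) :=
  Finsupp.mapRange.addMonoidHom (AddMonoidHom.mulLeft a)

/-- Left multiplication by `t`: as `t b = σ(b) t + δ(b)`, it is
`∑ b_j t^j ↦ ∑ σ(b_j) t^(j+1) + ∑ δ(b_j) t^j`. -/
def tOp (δ : SkewDerivation σ) : AddMonoid.End (ℕ →₀ k) :=
  (Finsupp.mapDomain.addMonoidHom Nat.succ).comp
      (Finsupp.mapRange.addMonoidHom (σ : k ≃+ k).toAddMonoidHom) +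
    Finsupp.mapRange.addMonoidHom δ.toAddMonoidHom

/-- Left multiplication by `p = ∑ a_i t^i`: it is `q ↦ ∑ a_i (t^i q)`. -/
def leftMul (p : OrePolynomial δ) : AddMonoid.End (ℕ →₀ k) :=
  p.toFinsupp.sum fun i a => smulOp a * tOp δ ^ i

instance : Zero (OrePolynomial δ) := ⟨⟨0⟩⟩
instance : One (OrePolynomial δ) := ⟨⟨Finsupp.single 0 1⟩⟩
instance : Add (OrePolynomial δ) := ⟨fun p q => ⟨p.toFinsupp + q.toFinsupp⟩⟩
instance : Neg (OrePolynomial δ) := ⟨fun p => ⟨-p.toFinsupp⟩⟩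

/-- The product determined by `t b = σ(b) t + δ(b)`: for `p = ∑ a_i t^i`, it is
`p * q = ∑ a_i (t^i q)`. -/
instance : Mul (OrePolynomial δ) := ⟨fun p q => ⟨leftMul p q.toFinsupp⟩⟩

theorem smulOp_apply (a : k) (p : ℕ →₀ k) (n : ℕ) : smulOp a p n = a * p n := rfl

theorem tOp_single (i : ℕ) (b : k) : tOp δ (Finsupp.single i b) =
    Finsupp.single (i + 1) (σ b) + Finsupp.single i (δ.toEnd b) := by
  change Finsupp.mapDomain Nat.succ (Finsupp.mapRange σ (map_zero σ) (Finsupp.single i b)) +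
    Finsupp.mapRange δ.toEnd (map_zero δ.toEnd) (Finsupp.single i b) = _
  rw [Finsupp.mapRange_single, Finsupp.mapRange_single, Finsupp.mapDomain_single]

theorem smulOp_single (a : k) (i : ℕ) (b : k) :
    smulOp a (Finsupp.single i b) = Finsupp.single i (a * b) :=
  Finsupp.mapRange_single (hf := mul_zero a)

theorem smulOp_add (a b : k) : smulOp (a + b) = smulOp a + smulOp b := by
  refine AddMonoidHom.ext fun p => Finsupp.ext fun n => ?_
  exact add_mul a b (p n)

theorem smulOp_mul (a b : k) : smulOp (a * b) = smulOp a * smulOp b := by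
  refine AddMonoidHom.ext fun p => Finsupp.ext fun n => ?_
  exact mul_assoc a b (p n)

theorem smulOp_zero : smulOp (0 : k) = 0 := by
  refine AddMonoidHom.ext fun p => Finsupp.ext fun n => ?_
  exact zero_mul (p n)

theorem smulOp_one : smulOp (1 : k) = 1 := by
  refine AddMonoidHom.ext fun p => Finsupp.ext fun n => ?_
  exact one_mul (p n)

theorem tOp_apply_zero (p : ℕ →₀ k) : tOp δ p 0 = δ.toEnd (p 0) := by
  change Finsupp.mapDomain Nat.succ (Finsupp.mapRange σ (map_zero σ) p) 0 + δ.toEnd (p 0) = _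
  rw [Finsupp.mapDomain_of_notMem_range, zero_add]
  rintro ⟨n, hn⟩
  exact Nat.succ_ne_zero n hn

theorem tOp_apply_succ (p : ℕ →₀ k) (n : ℕ) :
    tOp δ p (n + 1) = σ (p n) + δ.toEnd (p (n + 1)) := by
  change Finsupp.mapDomain Nat.succ (Finsupp.mapRange σ (map_zero σ) p) (Nat.succ n) +
    δ.toEnd (p (n + 1)) = _
  rw [Finsupp.mapDomain_apply Nat.succ_injective]
  rfl

/-- `t a = σ(a) t + δ(a)`, as operators. -/
theorem tOp_mul_smulOp (a : k) :
    tOp δ * smulOp a = smulOp (σ a) * tOp δ + smulOp (δ.toEnd a) := by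
  refine AddMonoidHom.ext fun p => Finsupp.ext fun n => ?_
  change tOp δ (smulOp a p) n = σ a * tOp δ p n + δ.toEnd a * p n
  cases n with
  | zero => rw [tOp_apply_zero, tOp_apply_zero, smulOp_apply, SkewDerivation.leibniz]
  | succ n =>
    rw [tOp_apply_succ, tOp_apply_succ, smulOp_apply, smulOp_apply, SkewDerivation.leibniz,
      map_mul, mul_add, add_assoc]

theorem leftMul_add (p q : OrePolynomial δ) : leftMul (p + q) = leftMul p + leftMul q := by
  refine Finsupp.sum_add_index' (fun i => ?_) (fun i a b => ?_)
  · rw [smulOp_zero, zero_mul]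
  · rw [smulOp_add, add_mul]

theorem leftMul_zero : leftMul (0 : OrePolynomial δ) = 0 := Finsupp.sum_zero_index

theorem leftMul_single (i : ℕ) (a : k) :
    leftMul (δ := δ) ⟨Finsupp.single i a⟩ = smulOp a * tOp δ ^ i :=
  Finsupp.sum_single_index (by rw [smulOp_zero, zero_mul])

theorem leftMul_smulOp (a : k) (q : ℕ →₀ k) :
    leftMul (δ := δ) ⟨smulOp a q⟩ = smulOp a * leftMul (δ := δ) ⟨q⟩ := by
  induction q using Finsupp.induction_linear with
  | zero => rw [map_zero]; exact leftMul_zero.trans (by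
      rw [show leftMul (δ := δ) ⟨0⟩ = 0 from leftMul_zero, mul_zero])
  | add p q hp hq =>
    rw [map_add]
    refine (leftMul_add (δ := δ) ⟨smulOp a p⟩ ⟨smulOp a q⟩).trans ?_
    rw [hp, hq, ← mul_add]
    exact congrArg _ (leftMul_add (δ := δ) ⟨p⟩ ⟨q⟩).symm
  | single i b => rw [smulOp_single, leftMul_single, leftMul_single, smulOp_mul, mul_assoc]

theorem leftMul_tOp (q : ℕ →₀ k) : leftMul (δ := δ) ⟨tOp δ q⟩ = tOp δ * leftMul (δ := δ) ⟨q⟩ := by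
  induction q using Finsupp.induction_linear with
  | zero => rw [map_zero]; exact leftMul_zero.trans (by
      rw [show leftMul (δ := δ) ⟨0⟩ = 0 from leftMul_zero, mul_zero])
  | add p q hp hq =>
    rw [map_add]
    refine (leftMul_add (δ := δ) ⟨tOp δ p⟩ ⟨tOp δ q⟩).trans ?_
    rw [hp, hq, ← mul_add]
    exact congrArg _ (leftMul_add (δ := δ) ⟨p⟩ ⟨q⟩).symm
  | single i b =>
    rw [tOp_single, leftMul_single, ← mul_assoc, tOp_mul_smulOp, add_mul, mul_assoc, ← pow_succ']
    refine (leftMul_add (δ := δ) ⟨Finsupp.single (i + 1) (σ b)⟩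
      ⟨Finsupp.single i (δ.toEnd b)⟩).trans ?_
    rw [leftMul_single, leftMul_single]

theorem leftMul_tOp_pow (i : ℕ) (q : ℕ →₀ k) :
    leftMul (δ := δ) ⟨(tOp δ ^ i) q⟩ = tOp δ ^ i * leftMul (δ := δ) ⟨q⟩ := by
  induction i with
  | zero => rw [pow_zero, one_mul]; rfl
  | succ i ih =>
    rw [pow_succ', mul_assoc, ← ih]
    exact leftMul_tOp _

theorem leftMul_mul (p q : OrePolynomial δ) : leftMul (p * q) = leftMul p * leftMul q := by
  obtain ⟨p⟩ := p
  induction p using Finsupp.induction_linear with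
  | zero =>
    have h : (⟨0⟩ : OrePolynomial δ) * q = 0 :=
      OrePolynomial.ext (DFunLike.congr_fun leftMul_zero q.toFinsupp)
    rw [h, show leftMul (δ := δ) ⟨0⟩ = 0 from leftMul_zero, zero_mul, leftMul_zero]
  | add p p' hp hp' =>
    have h : (⟨p + p'⟩ : OrePolynomial δ) * q = ⟨p⟩ * q + ⟨p'⟩ * q :=
      OrePolynomial.ext (DFunLike.congr_fun (leftMul_add ⟨p⟩ ⟨p'⟩) q.toFinsupp)
    rw [h, leftMul_add, hp, hp', ← add_mul, ← leftMul_add]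
    exact congrArg (· * leftMul q) rfl
  | single i a =>
    have h : (⟨Finsupp.single i a⟩ : OrePolynomial δ) * q =
        ⟨smulOp a ((tOp δ ^ i) q.toFinsupp)⟩ :=
      OrePolynomial.ext (DFunLike.congr_fun (leftMul_single i a) q.toFinsupp)
    rw [h, leftMul_smulOp, leftMul_tOp_pow, leftMul_single, mul_assoc]

theorem tOp_pow_one (i : ℕ) :
    (tOp δ ^ i) (Finsupp.single 0 1) = Finsupp.single i 1 := by
  induction i with
  | zero => rfl
  | succ i ih =>
    rw [pow_succ']
    change tOp δ ((tOp δ ^ i) (Finsupp.single 0 1)) = _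
    rw [ih, tOp_single, map_one, SkewSeries.toEnd_one, Finsupp.single_zero, add_zero]

theorem leftMul_apply_one (p : OrePolynomial δ) :
    leftMul p (Finsupp.single 0 1) = p.toFinsupp := by
  obtain ⟨p⟩ := p
  induction p using Finsupp.induction_linear with
  | zero => exact DFunLike.congr_fun (leftMul_zero (δ := δ)) _
  | add p q hp hq =>
    exact (DFunLike.congr_fun (leftMul_add ⟨p⟩ ⟨q⟩) _).trans (congrArg₂ (· + ·) hp hq)
  | single i a =>
    rw [leftMul_single]
    change smulOp a ((tOp δ ^ i) (Finsupp.single 0 1)) = _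
    rw [tOp_pow_one, smulOp_single, mul_one]

theorem leftMul_one : leftMul (1 : OrePolynomial δ) = 1 := by
  refine (leftMul_single 0 1).trans ?_
  rw [smulOp_one, pow_zero, mul_one]

instance : Ring (OrePolynomial δ) :=
  Ring.ofMinimalAxioms
    (fun _ _ _ => OrePolynomial.ext (add_assoc _ _ _))
    (fun _ => OrePolynomial.ext (zero_add _))
    (fun _ => OrePolynomial.ext (neg_add_cancel _))
    (fun p q r => OrePolynomial.ext (DFunLike.congr_fun (leftMul_mul p q) r.toFinsupp))
    (fun p => OrePolynomial.ext (DFunLike.congr_fun leftMul_one p.toFinsupp))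
    (fun p => OrePolynomial.ext (leftMul_apply_one p))
    (fun _ _ _ => OrePolynomial.ext (map_add _ _ _))
    (fun p q r => OrePolynomial.ext (DFunLike.congr_fun (leftMul_add p q) r.toFinsupp))

/-- The coefficients of index greater than or equal to `n` vanish. -/
def DegLt (p : ℕ →₀ k) (n : ℕ) : Prop := ∀ m, n ≤ m → p m = 0

theorem degLt_tOp_pow {q : ℕ →₀ k} {n : ℕ} (hq : DegLt q (n + 1)) (i : ℕ) :
    DegLt ((tOp δ ^ i) q) (n + i + 1) ∧ ((tOp δ ^ i) q) (n + i) = (σ ^ i) (q n) := by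
  induction i with
  | zero => exact ⟨hq, rfl⟩
  | succ i ih =>
    rw [pow_succ', pow_succ']
    change DegLt (tOp δ ((tOp δ ^ i) q)) _ ∧ tOp δ ((tOp δ ^ i) q) _ = σ ((σ ^ i) (q n))
    refine ⟨fun m hm => ?_, ?_⟩
    · obtain ⟨m, rfl⟩ : ∃ m', m = m' + 1 := ⟨m - 1, by omega⟩
      rw [tOp_apply_succ, ih.1 m (by omega), ih.1 (m + 1) (by omega), map_zero, map_zero, add_zero]
    · rw [← add_assoc, tOp_apply_succ, ih.2, ih.1 _ le_rfl, map_zero, add_zero]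

theorem leftMul_apply {p : OrePolynomial δ} {m : ℕ} (hp : DegLt p.toFinsupp (m + 1)) (q : ℕ →₀ k)
    (l : ℕ) : leftMul p q l = ∑ i ∈ Finset.range (m + 1), p.toFinsupp i * ((tOp δ ^ i) q) l := by
  have h : leftMul p = ∑ i ∈ Finset.range (m + 1), smulOp (p.toFinsupp i) * tOp δ ^ i := by
    refine Finsupp.sum_of_support_subset _ (fun i hi => ?_) _ fun i _ => ?_
    · rw [Finset.mem_range]
      by_contra h
      exact (Finsupp.mem_support_iff.mp hi) (hp i (by omega))
    · rw [smulOp_zero, zero_mul]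
  rw [h]
  refine (DFunLike.congr_fun (AddMonoidHom.finsetSum_apply _ _ q) l).trans ?_
  exact Finsupp.finsetSum_apply _ _ _

theorem degLt_mul {p q : OrePolynomial δ} {m n : ℕ} (hp : DegLt p.toFinsupp (m + 1))
    (hq : DegLt q.toFinsupp (n + 1)) : DegLt (p * q).toFinsupp (m + n + 1) ∧
      (p * q).toFinsupp (m + n) = p.toFinsupp m * (σ ^ m) (q.toFinsupp n) := by
  refine ⟨fun l hl => (leftMul_apply hp _ _).trans (Finset.sum_eq_zero fun i hi => ?_),
    (leftMul_apply hp _ _).trans ?_⟩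
  · rw [Finset.mem_range] at hi
    rw [(degLt_tOp_pow hq i).1 l (by omega), mul_zero]
  · rw [Finset.sum_range_succ, Finset.sum_eq_zero, zero_add, add_comm m n, (degLt_tOp_pow hq m).2]
    intro i hi
    rw [Finset.mem_range] at hi
    rw [(degLt_tOp_pow hq i).1 _ (by omega), mul_zero]

theorem exists_deg {p : OrePolynomial δ} (hp : p ≠ 0) :
    ∃ m, p.toFinsupp m ≠ 0 ∧ DegLt p.toFinsupp (m + 1) := by
  have h0 : p.toFinsupp.support.Nonempty :=
    Finsupp.support_nonempty_iff.mpr fun h => hp (OrePolynomial.ext h)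
  refine ⟨p.toFinsupp.support.max' h0,
    Finsupp.mem_support_iff.mp (Finset.max'_mem _ h0), fun m hm => ?_⟩
  by_contra h
  have := Finset.le_max' _ m (Finsupp.mem_support_iff.mpr h)
  omega

instance : NoZeroDivisors (OrePolynomial δ) where
  eq_zero_or_eq_zero_of_mul_eq_zero {p q} h := by
    by_contra! hpq
    obtain ⟨m, hm, hm'⟩ := exists_deg hpq.1
    obtain ⟨n, hn, hn'⟩ := exists_deg hpq.2
    have h1 := (degLt_mul hm' hn').2
    rw [h] at h1
    exact mul_ne_zero hm ((map_ne_zero (σ ^ m)).mpr hn) h1.symm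

instance : Nontrivial (OrePolynomial δ) := ⟨⟨0, 1, fun h => by
  have h1 := congrArg (fun p => p.toFinsupp 0) h
  exact zero_ne_one (h1.trans (Finsupp.single_eq_same (a := 0) (b := (1 : k))))⟩⟩

theorem exists_quotient {s : OrePolynomial δ} {n : ℕ} (hn : s.toFinsupp n ≠ 0)
    (hs : DegLt s.toFinsupp (n + 1)) (N : ℕ) (r : OrePolynomial δ) (hr : DegLt r.toFinsupp N) :
    ∃ q, DegLt (r - q * s).toFinsupp n := by
  induction N generalizing r with
  | zero => exact ⟨0, fun m _ => by rw [zero_mul, sub_zero]; exact hr m (Nat.zero_le m)⟩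
  | succ N ih =>
    by_cases hN : N < n
    · exact ⟨0, fun m hm => by rw [zero_mul, sub_zero]; exact hr m (by omega)⟩
    obtain ⟨d, rfl⟩ : ∃ d, N = d + n := ⟨N - n, by omega⟩
    set c := r.toFinsupp (d + n) * ((σ ^ d) (s.toFinsupp n))⁻¹
    set u : OrePolynomial δ := ⟨Finsupp.single d c⟩
    have hu : DegLt u.toFinsupp (d + 1) := fun m hm => Finsupp.single_eq_of_ne (by omega)
    have hud : u.toFinsupp d = c := Finsupp.single_eq_same
    have hus := degLt_mul hu hs
    obtain ⟨q, hq⟩ := ih (r - u * s) (fun m hm => by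
      have e : (r - u * s).toFinsupp m = r.toFinsupp m - (u * s).toFinsupp m := by
        rw [sub_eq_add_neg, sub_eq_add_neg]; rfl
      rw [e]
      obtain rfl | hm := hm.eq_or_lt
      · rw [hus.2, hud, inv_mul_cancel_right₀ ((map_ne_zero (σ ^ d)).mpr hn), sub_self]
      · rw [hr m hm, hus.1 m hm, sub_zero])
    exact ⟨u + q, by rwa [add_mul, ← sub_sub]⟩

theorem exists_left_multiple (n : ℕ) (r s : OrePolynomial δ) (hs : s ≠ 0)
    (hn : DegLt s.toFinsupp n) : ∃ r' s', s' ≠ 0 ∧ s' * r = r' * s := by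
  induction n using Nat.strong_induction_on generalizing r s with
  | _ n ih =>
    obtain ⟨m, hm, hm'⟩ := exists_deg hs
    have hmn : m < n := by
      by_contra h
      exact hm (hn m (by omega))
    have hrN : ∃ N, DegLt r.toFinsupp N := by
      by_cases hr : r = 0
      · exact ⟨0, fun _ _ => by rw [hr]; rfl⟩
      · exact ⟨_, (exists_deg hr).choose_spec.2⟩
    obtain ⟨N, hN⟩ := hrN
    obtain ⟨q, hq⟩ := exists_quotient hm hm' N r hN
    by_cases h0 : r - q * s = 0
    · exact ⟨q, 1, one_ne_zero, by rw [one_mul]; exact sub_eq_zero.mp h0⟩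
    · obtain ⟨a, b, hb, hab⟩ := ih m hmn s (r - q * s) h0 hq
      have ha : a ≠ 0 := by
        rintro rfl
        rw [zero_mul] at hab
        exact mul_ne_zero hb hs hab
      refine ⟨a * q + b, a, ha, ?_⟩
      rw [add_mul, hab, mul_sub, mul_assoc]
      abel

open nonZeroDivisors in
/-- Since `k[t,σ,δ]` is left Euclidean, its nonzero elements satisfy the Ore condition. -/
instance : OreLocalization.OreSet (OrePolynomial δ)⁰ :=
  (OreLocalization.nonempty_oreSet_iff_of_noZeroDivisors.mpr fun r s => by
    obtain ⟨m, hm⟩ := exists_deg (nonZeroDivisors.ne_zero s.2)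
    obtain ⟨r', s', hs', h⟩ :=
      exists_left_multiple (m + 1) r s (nonZeroDivisors.ne_zero s.2) hm.2
    exact ⟨r', ⟨s', mem_nonZeroDivisors_of_ne_zero hs'⟩, h⟩).some

/-- The inclusion of `k` into `k[t,σ,δ]` as the constant polynomials. -/
def const (δ : SkewDerivation σ) : k →+* OrePolynomial δ where
  toFun a := ⟨Finsupp.single 0 a⟩
  map_one' := rfl
  map_zero' := OrePolynomial.ext (Finsupp.single_zero 0)
  map_add' a b := OrePolynomial.ext (Finsupp.single_add 0 a b)
  map_mul' a b := by
    refine OrePolynomial.ext ?_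
    change _ = leftMul (δ := δ) ⟨Finsupp.single 0 a⟩ (Finsupp.single 0 b)
    rw [leftMul_single, pow_zero, mul_one, smulOp_single]

/-- The indeterminate `t`. -/
def t (δ : SkewDerivation σ) : OrePolynomial δ := ⟨Finsupp.single 1 1⟩

theorem t_mul_const (a : k) : t δ * const δ a = const δ (σ a) * t δ + const δ (δ.toEnd a) := by
  refine OrePolynomial.ext ?_
  change leftMul (δ := δ) ⟨Finsupp.single 1 1⟩ (Finsupp.single 0 a) =
    leftMul (δ := δ) ⟨Finsupp.single 0 (σ a)⟩ (Finsupp.single 1 1) + Finsupp.single 0 (δ.toEnd a)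
  rw [leftMul_single, leftMul_single, pow_one, smulOp_one, one_mul, tOp_single, pow_zero, mul_one,
    smulOp_single, mul_one]

end OrePolynomial

/-- The skew rational fraction field `k(t,σ,δ)`: the field of fractions of the Ore domain
`k[t,σ,δ]`. -/
abbrev SkewRationalFunction {k : Type*} [DivisionRing k] {σ : k ≃+* k} (δ : SkewDerivation σ) :
    Type _ :=
  OreLocalization (nonZeroDivisors (OrePolynomial δ)) (OrePolynomial δ)

/-- The inclusion of `k` into `k(t,σ,δ)` as the constant fractions. -/
def SkewRationalFunction.const {k : Type*} [DivisionRing k] {σ : k ≃+* k}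
    (δ : SkewDerivation σ) : k →+* SkewRationalFunction δ :=
  OreLocalization.numeratorRingHom.comp (OrePolynomial.const δ)

end

/-! ### Discrete valuations and regular extensions. -/

section Valued

variable {k K : Type*} [DivisionRing k] [DivisionRing K]

/-! All three cases follow from one valuation criterion, `isRegularExtension_of_addValuation`.
Suppose `K` carries a valuation `v` with values in `ℤ ∪ {∞}` which is trivial on `k` and for which
every element of valuation `0` is congruent to a constant modulo elements of positive valuation. Let
`x` be algebraic over `k`. If some nonzero `y` in `k(x)` had `v y ≠ 0`, the nonzero terms of a left
linear combination `∑ c_n y^n` would have pairwise distinct valuations `n • v y`, so the sum could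
vanish only trivially. The powers of `y` would then be an infinite left independent family in the
finite-dimensional space `k(x)`, a contradiction. Hence `v` vanishes on all nonzero elements of
`k(x)`. If `x ≠ 0`, choose a constant `a` with `v (x - a) > 0`; since `x - a` lies in `k(x)`, it
must be zero.

On the two series fields `v` is the order of a series. It is multiplicative (`orderTop_mul`) because
the lowest coefficient of a product is the product of the lowest coefficients, one of them twisted
by a power of `σ`; the contributions of `δ` only appear in higher degree. The residue of a series of
order `0` is its constant coefficient.

The fraction field embeds over `k` in `k_{σ,δ}((z))` by `t ↦ z⁻¹`: the commutation rule of `z`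
becomes `z⁻¹ a = σ(a) z⁻¹ + δ(a)` (`zInv_mul_const`), and nonzero polynomials have nonzero image
because `z⁻¹` has valuation `-1`, by the same independence of powers. The criterion then applies to
the restricted valuation. -/

theorem AddValuation.eq_zero_of_sum_eq_zero (v : AddValuation K (WithTop ℤ)) {ι : Type*}
    (s : Finset ι) (f : ι → K)
    (hf : ∀ m n, f m ≠ 0 → f n ≠ 0 → v (f m) = v (f n) → m = n) (hs : ∑ n ∈ s, f n = 0) :
    ∀ n ∈ s, f n = 0 := by
  classical
  by_contra! h
  obtain ⟨l, hl, hl0⟩ := h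
  -- A nonzero term of least valuation is the only one with that valuation, by `hf`, so the
  -- remaining terms cannot cancel it.
  obtain ⟨n, hn, hmin⟩ := Finset.exists_min_image (s.filter fun n => f n ≠ 0) (fun n => v (f n))
    ⟨l, Finset.mem_filter.mpr ⟨hl, hl0⟩⟩
  obtain ⟨hns, hn0⟩ := Finset.mem_filter.mp hn
  have hvn : v (f n) ≠ ⊤ := fun h => hn0 (v.top_iff.mp h)
  have hlt : v (f n) < v (∑ m ∈ s.erase n, f m) := by
    refine AddValuation.map_lt_sum v hvn fun m hm => ?_
    obtain ⟨hmn, hms⟩ := Finset.mem_erase.mp hm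
    by_cases hm0 : f m = 0
    · rw [hm0, v.map_zero]
      exact lt_top_iff_ne_top.mpr hvn
    · exact lt_of_le_of_ne (hmin m (Finset.mem_filter.mpr ⟨hms, hm0⟩))
        fun h => hmn (hf m n hm0 hn0 h.symm)
  -- The vanishing sum makes this term the opposite of the rest, hence of equal valuation, against
  -- `hlt`.
  rw [← Finset.add_sum_erase s f hns, add_eq_zero_iff_eq_neg] at hs
  rw [hs, v.map_neg] at hlt
  exact lt_irrefl _ hlt

/-- Both exclusions matter: all multiples of `0` agree, and so do all positive multiples of `⊤`.
Once `c` is a nonzero integer, it can be cancelled. This separates the valuations of the powers of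
an element. -/
theorem WithTop.nsmul_intCast_injective {c : WithTop ℤ} (hc : c ≠ 0) (hc' : c ≠ ⊤) {m n : ℕ}
    (h : m • c = n • c) : m = n := by
  lift c to ℤ using hc'
  have h' : m • c = n • c := by exact_mod_cast h
  have hc0 : c ≠ 0 := by exact_mod_cast hc
  rw [nsmul_eq_mul, nsmul_eq_mul] at h'
  exact_mod_cast mul_right_cancel₀ hc0 h'

/-- Powers of an element of nonzero valuation are left linearly independent over a subfield of
valuation zero. -/
theorem AddValuation.coeff_eq_zero_of_sum_mul_pow_eq_zero (v : AddValuation K (WithTop ℤ))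
    (i : k →+* K) (hi : ∀ a ≠ 0, v (i a) = 0) {y : K} (hy0 : y ≠ 0) (hy : v y ≠ 0)
    (s : Finset ℕ) (c : ℕ → k) (hs : ∑ n ∈ s, i (c n) * y ^ n = 0) : ∀ n ∈ s, c n = 0 := by
  -- A nonzero coefficient has valuation `0`, so the valuation of a nonzero term depends only on the
  -- exponent.
  have hv : ∀ n, i (c n) * y ^ n ≠ 0 → v (i (c n) * y ^ n) = n • v y := by
    intro n hn
    have hc : c n ≠ 0 := by
      intro h
      rw [h, _root_.map_zero, zero_mul] at hn
      exact hn rfl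
    rw [v.map_mul, hi _ hc, zero_add, v.map_pow]
  intro n hn
  have h := v.eq_zero_of_sum_eq_zero s (fun n => i (c n) * y ^ n) (fun m n hm hn h => by
    rw [hv m hm, hv n hn] at h
    exact WithTop.nsmul_intCast_injective hy (fun h => hy0 (v.top_iff.mp h)) h) hs n hn
  exact (map_eq_zero i).mp ((mul_eq_zero.mp h).resolve_right (pow_ne_zero n hy0))

/-- A discretely valued extension of `k`, trivially valued on `k` and with residue field `k`, is
regular. -/
theorem isRegularExtension_of_addValuation (i : k →+* K) (v : AddValuation K (WithTop ℤ))
    (hi : ∀ a ≠ 0, v (i a) = 0) (hres : ∀ x, v x = 0 → ∃ a, 0 < v (x - i a)) :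
    IsRegularExtension i := by
  intro x hx
  have hfin := hx.1
  -- The valuation is trivial on all of `k(x)`, not just at `x`; this is applied below to `x` and to
  -- `x - i a`.
  have key : ∀ y ∈ adjoinElem i x, y ≠ 0 → v y = 0 := by
    intro y hy hy0
    by_contra hvy
    unfold LeftFinite at hfin
    -- The same module structure as inside `LeftFinite`, so that `hfin` can be read as an ordinary
    -- finiteness statement.
    let _ : Module k (adjoinElem i x) := Module.compHom _ (toAdjoinElem i x)
    have hfin' : Module.Finite k (adjoinElem i x) := hfin
    have hli : LinearIndependent k fun n : ℕ => (⟨y, hy⟩ : adjoinElem i x) ^ n := by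
      rw [linearIndependent_iff']
      intro s c hs
      refine v.coeff_eq_zero_of_sum_mul_pow_eq_zero i hi hy0 hvy s c ?_
      -- Scalars act by left multiplication through `i`, so the image in `K` of the dependence
      -- relation unfolds to `∑ i (c n) * y ^ n = 0`.
      have h := congrArg (adjoinElem i x).subtype hs
      rw [map_sum, map_zero] at h
      exact h
    exact Infinite.not_finite (α := ℕ) hli.finite
  have hxmem : x ∈ adjoinElem i x := Subfield.subset_closure (Or.inr rfl)
  -- Zero has valuation `⊤`, so `hres` says nothing about it.
  by_cases hx0 : x = 0
  · exact ⟨0, by rw [hx0, map_zero]⟩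
  obtain ⟨a, ha⟩ := hres x (key x hxmem hx0)
  refine ⟨a, ?_⟩
  by_contra hne
  -- If `x - i a` were nonzero, `key` would give it valuation `0`, whereas `ha` makes its valuation
  -- positive.
  refine ha.ne' (key _ (sub_mem hxmem (toAdjoinElem i x a).2) fun h => hne ?_)
  exact (sub_eq_zero.mp h).symm

end Valued

/-! ### Orders and lowest coefficients of Laurent series. -/

namespace LaurentOperators

/-- The valuations below use `orderTop` rather than `order`, since the zero series must have value
`⊤`. -/
theorem orderTop_eq_coe {R : Type*} [Zero R] {x : HahnSeries ℤ R} {a : ℤ} (hx : Above x a)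
    (h : x.coeff a ≠ 0) : x.orderTop = a := by
  refine le_antisymm (HahnSeries.orderTop_le_of_coeff_ne_zero h) ?_
  refine HahnSeries.le_orderTop_iff_forall.mpr fun n hn => ?_
  exact hx n (by exact_mod_cast hn)

theorem exists_lead {R : Type*} [Zero R] {x : HahnSeries ℤ R} (hx : x ≠ 0) :
    ∃ a, Above x a ∧ x.coeff a ≠ 0 :=
  ⟨x.order, fun _ hn => HahnSeries.coeff_eq_zero_of_lt_order hn,
    mt HahnSeries.coeff_order_eq_zero.mp hx⟩

/-- The constant coefficient is the residue: removing it cancels index `0`, and a series of order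
`0` has nothing at negative indices. This supplies the residue condition of the regularity criterion
for both series fields. -/
theorem orderTop_sub_single_pos {R : Type*} [AddGroup R] {x : HahnSeries ℤ R}
    (hx : x.orderTop = 0) : 0 < (x - HahnSeries.single 0 (x.coeff 0)).orderTop := by
  rw [← not_le]
  intro h
  -- If the order were not positive, the difference would be nonzero with lowest index `a ≤ 0`,
  -- where its coefficient is in fact zero.
  obtain ⟨a, ha, ha0⟩ := exists_lead (x := x - HahnSeries.single 0 (x.coeff 0)) (by
    rintro h0
    rw [h0, HahnSeries.orderTop_zero] at h
    exact absurd h (by simp))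
  rw [orderTop_eq_coe ha ha0] at h
  have h' : a ≤ 0 := by exact_mod_cast h
  apply ha0
  rw [HahnSeries.coeff_sub]
  obtain rfl | hlt := h'.eq_or_lt
  · rw [HahnSeries.coeff_single_same, sub_self]
  · rw [HahnSeries.coeff_single_of_ne hlt.ne, sub_zero]
    refine HahnSeries.coeff_eq_zero_of_lt_orderTop ?_
    rw [hx]
    exact_mod_cast hlt

variable {k : Type*} [DivisionRing k]

/-- Only the pair of lowest indices `(a, b)` contributes at index `a + b`. -/
theorem app_lead {Φ : HahnSeries ℤ (AddMonoid.End k)} {x : HahnSeries ℤ k} {a b : ℤ}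
    (hΦ : Above Φ a) (hx : Above x b) : (app Φ x).coeff (a + b) = Φ.coeff a (x.coeff b) := by
  rw [app_coeff hΦ hx, add_sub_cancel_right, Finset.Icc_self, Finset.sum_singleton,
    add_sub_cancel_left]

end LaurentOperators

noncomputable section

open LaurentOperators

/-! ### The `t`-adic valuation and regularity of `k((t,σ))`. -/

namespace SkewLaurentSeries

variable {k : Type*} [DivisionRing k] {σ : k ≃+* k}

/-- For nonzero series the lowest coefficient of the product is `s_a σ^a(t_b)`, which is nonzero
since `σ^a` is injective and `k` has no zero divisors. A zero factor gives `⊤` on both sides. -/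
theorem orderTop_mul (S T : SkewLaurentSeries σ) :
    (S * T).toSeries.orderTop = S.toSeries.orderTop + T.toSeries.orderTop := by
  by_cases hS : S = 0
  · rw [hS, zero_mul]
    exact HahnSeries.orderTop_zero.trans
      ((congrArg (· + T.toSeries.orderTop) HahnSeries.orderTop_zero).trans (top_add _)).symm
  by_cases hT : T = 0
  · rw [hT, mul_zero]
    exact HahnSeries.orderTop_zero.trans
      ((congrArg (S.toSeries.orderTop + ·) HahnSeries.orderTop_zero).trans (add_top _)).symm
  obtain ⟨a, ha, ha0⟩ := exists_lead fun h => hS (SkewLaurentSeries.ext h)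
  obtain ⟨b, hb, hb0⟩ := exists_lead fun h => hT (SkewLaurentSeries.ext h)
  rw [orderTop_eq_coe ha ha0, orderTop_eq_coe hb hb0]
  refine orderTop_eq_coe ((above_leftMul ha).app hb) ?_
  refine ne_of_eq_of_ne (app_lead (above_leftMul ha) hb) ?_
  rw [leftMul_coeff_apply]
  exact mul_ne_zero ha0 ((map_ne_zero (σ ^ a)).mpr hb0)

/-- The `t`-adic valuation of `k((t,σ))`. -/
def addVal (σ : k ≃+* k) : AddValuation (SkewLaurentSeries σ) (WithTop ℤ) :=
  AddValuation.of (fun S => S.toSeries.orderTop) HahnSeries.orderTop_zero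
    (HahnSeries.orderTop_single one_ne_zero)
    (fun _ _ => HahnSeries.min_orderTop_le_orderTop_add) orderTop_mul

theorem isRegularExtension_const (σ : k ≃+* k) :
    IsRegularExtension (SkewLaurentSeries.const σ) := by
  refine isRegularExtension_of_addValuation _ (addVal σ)
    (fun a ha => HahnSeries.orderTop_single ha) fun S hS => ⟨S.toSeries.coeff 0, ?_⟩
  -- Addition and negation of skew series are coefficientwise by definition; writing both
  -- differences as sums lets the Laurent series statement apply as it stands.
  rw [sub_eq_add_neg]
  have h := orderTop_sub_single_pos (x := S.toSeries) hS
  rwa [sub_eq_add_neg] at h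

end SkewLaurentSeries

/-! ### The `z`-adic valuation of `k_{σ,δ}((z))`, its subextensions, and the element `z⁻¹`. -/

namespace SkewSeries

variable {k : Type*} [DivisionRing k] {σ : k ≃+* k} {δ : SkewDerivation σ}

/-- Right multiplication by `T` has lowest operator `x ↦ σ^b(x) t_b`, free of `δ`, so the lowest
coefficient of the product is `σ^b(s_a) t_b ≠ 0`. -/
theorem orderTop_mul (S T : SkewSeries δ) :
    (S * T).toSeries.orderTop = S.toSeries.orderTop + T.toSeries.orderTop := by
  by_cases hS : S = 0
  · rw [hS, zero_mul]
    exact HahnSeries.orderTop_zero.trans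
      ((congrArg (· + T.toSeries.orderTop) HahnSeries.orderTop_zero).trans (top_add _)).symm
  by_cases hT : T = 0
  · rw [hT, mul_zero]
    exact HahnSeries.orderTop_zero.trans
      ((congrArg (S.toSeries.orderTop + ·) HahnSeries.orderTop_zero).trans (add_top _)).symm
  obtain ⟨a, ha, ha0⟩ := exists_lead fun h => hS (SkewSeries.ext h)
  obtain ⟨b, hb, hb0⟩ := exists_lead fun h => hT (SkewSeries.ext h)
  -- The operator series comes from the right factor `T`, so its order `b` has to stand first.
  rw [orderTop_eq_coe ha ha0, orderTop_eq_coe hb hb0, add_comm]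
  refine orderTop_eq_coe ((above_rightMul hb).app ha) ?_
  refine ne_of_eq_of_ne (app_lead (above_rightMul hb) ha) ?_
  rw [rightMul_coeff_self hb]
  change (autUnit σ ^ b).val _ * _ ≠ 0
  rw [autUnit_zpow_apply]
  exact mul_ne_zero ((map_ne_zero (σ ^ b)).mpr ha0) hb0

/-- The `z`-adic valuation of `k_{σ,δ}((z))`. -/
def addVal (δ : SkewDerivation σ) : AddValuation (SkewSeries δ) (WithTop ℤ) :=
  AddValuation.of (fun S => S.toSeries.orderTop) HahnSeries.orderTop_zero
    (HahnSeries.orderTop_single one_ne_zero)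
    (fun _ _ => HahnSeries.min_orderTop_le_orderTop_add) orderTop_mul

theorem addVal_const {a : k} (ha : a ≠ 0) : addVal δ (const δ a) = 0 :=
  HahnSeries.orderTop_single ha

theorem addVal_sub_const_pos {S : SkewSeries δ} (hS : addVal δ S = 0) :
    0 < addVal δ (S - const δ (S.toSeries.coeff 0)) := by
  rw [sub_eq_add_neg]
  have h := orderTop_sub_single_pos (x := S.toSeries) hS
  rwa [sub_eq_add_neg] at h

/-- An extension of `k` contained in `k_{σ,δ}((z))` is regular. -/
theorem isRegularExtension_of_ringHom {K : Type*} [DivisionRing K] (i : k →+* K)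
    (φ : K →+* SkewSeries δ) (hφ : ∀ a, φ (i a) = const δ a) : IsRegularExtension i := by
  -- Pull the valuation back along `φ`. The residue field stays `k` because `φ` fixes the constants:
  -- the residue of `x` is the constant coefficient of `φ x`.
  refine isRegularExtension_of_addValuation i ((addVal δ).comap φ) (fun a ha => ?_)
    fun x hx => ⟨(φ x).toSeries.coeff 0, ?_⟩
  · change addVal δ (φ (i a)) = 0
    rw [hφ]
    exact addVal_const ha
  · change 0 < addVal δ (φ (x - i _))
    rw [map_sub, hφ]
    exact addVal_sub_const_pos hx

/-- The element `z⁻¹`. -/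
def zInv (δ : SkewDerivation σ) : SkewSeries δ := ⟨HahnSeries.single (-1) 1⟩

theorem addVal_zInv : addVal δ (zInv δ) = ((-1 : ℤ) : WithTop ℤ) :=
  HahnSeries.orderTop_single one_ne_zero

theorem zInv_ne_zero : zInv δ ≠ 0 := fun h => by
  have h1 := addVal_zInv (δ := δ)
  rw [h, AddValuation.map_zero] at h1
  exact WithTop.top_ne_coe h1

/-- This is the defining relation of `k[t,σ,δ]` with `z⁻¹` in place of `t`. It is the rule `b z⁻¹ =
z⁻¹ σ⁻¹(b) - δ(σ⁻¹(b))` encoded by `zInvOp`, taken at `b = σ(a)`. -/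
theorem zInv_mul_const (a : k) :
    zInv δ * const δ a = const δ (σ a) * zInv δ + const δ (δ.toEnd a) := by
  refine SkewSeries.ext (HahnSeries.ext (funext fun n => ?_))
  change (app (rightMul (δ := δ) ⟨HahnSeries.single 0 a⟩) (HahnSeries.single (-1) 1)).coeff n =
    (app (rightMul (δ := δ) ⟨HahnSeries.single (-1) 1⟩) (HahnSeries.single 0 (σ a))).coeff n +
      (HahnSeries.single 0 (δ.toEnd a)).coeff n
  rw [app_single_zero_coeff, rightMul_single, rightMul_single, zpow_zero, Units.val_one, mul_one,
    single_app_coeff, HahnSeries.coeff_single_mul, sub_zero, zpow_neg_one]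
  change (HahnSeries.single (-1 : ℤ) (1 : k)).coeff n * a = (zInvOp δ).coeff n (σ a) * 1 + _
  rw [mul_one, ← app_single_zero_coeff, app_zInvOp_coeff]
  simp only [HahnSeries.coeff_single]
  -- Only two indices matter: at `-1` both sides are `a`, and at `0` the term `-δ(a)` from `zInvOp`
  -- cancels the added `δ(a)`.
  obtain h | h := eq_or_ne n (-1)
  · subst h
    simp
  · rw [if_neg h, if_neg (by omega : ¬ n + 1 = 0)]
    split_ifs <;> simp [negDelta_apply]

end SkewSeries

/-! ### Evaluation of skew polynomials at `z⁻¹`. -/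

namespace OrePolynomial

variable {k : Type*} [DivisionRing k] {σ : k ≃+* k} {δ : SkewDerivation σ}

/-- The evaluation of `∑ a_i t^i` at `t = z⁻¹`, as an additive map. -/
def evalAddHom (δ : SkewDerivation σ) : (ℕ →₀ k) →+ SkewSeries δ :=
  Finsupp.liftAddHom fun i =>
    (AddMonoidHom.mulRight (SkewSeries.zInv δ ^ i)).comp (SkewSeries.const δ).toAddMonoidHom

theorem evalAddHom_single (i : ℕ) (a : k) :
    evalAddHom δ (Finsupp.single i a) = SkewSeries.const δ a * SkewSeries.zInv δ ^ i :=
  Finsupp.liftAddHom_apply_single _ _ _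

theorem evalAddHom_smulOp (a : k) (q : ℕ →₀ k) :
    evalAddHom δ (smulOp a q) = SkewSeries.const δ a * evalAddHom δ q := by
  induction q using Finsupp.induction_linear with
  | zero => simp only [map_zero, mul_zero]
  | add p q hp hq => rw [map_add, map_add, map_add, hp, hq, mul_add]
  | single i b => rw [smulOp_single, evalAddHom_single, evalAddHom_single, map_mul, mul_assoc]

/-- On monomials this is exactly `zInv_mul_const`; it is where evaluation respects the twisted
commutation rule. -/
theorem evalAddHom_tOp (q : ℕ →₀ k) :
    evalAddHom δ (tOp δ q) = SkewSeries.zInv δ * evalAddHom δ q := by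
  induction q using Finsupp.induction_linear with
  | zero => simp only [map_zero, mul_zero]
  | add p q hp hq => rw [map_add, map_add, map_add, hp, hq, mul_add]
  | single i b =>
    rw [tOp_single, map_add, evalAddHom_single, evalAddHom_single, evalAddHom_single, ← mul_assoc,
      SkewSeries.zInv_mul_const, add_mul, pow_succ', mul_assoc]

/-- The product of polynomials is assembled from the operators `smulOp a` and `tOp δ`, which
evaluation turns into left multiplication by a constant and by `z⁻¹`. By additivity it is enough to
take a monomial for `p`. -/
theorem evalAddHom_leftMul (p q : ℕ →₀ k) :
    evalAddHom δ (leftMul (δ := δ) ⟨p⟩ q) = evalAddHom δ p * evalAddHom δ q := by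
  induction p using Finsupp.induction_linear with
  | zero =>
    rw [show leftMul (δ := δ) ⟨0⟩ = 0 from leftMul_zero, map_zero, zero_mul]
    exact map_zero _
  | add p p' hp hp' =>
    rw [show leftMul (δ := δ) ⟨p + p'⟩ = _ from leftMul_add ⟨p⟩ ⟨p'⟩, map_add, add_mul, ← hp, ← hp']
    exact map_add _ _ _
  | single i a =>
    have hpow : ∀ i : ℕ, evalAddHom δ ((tOp δ ^ i) q) =
        SkewSeries.zInv δ ^ i * evalAddHom δ q := by
      intro i
      induction i with
      | zero => rw [pow_zero, pow_zero, one_mul]; rfl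
      | succ i ih =>
        rw [pow_succ', pow_succ', mul_assoc, ← ih]
        exact evalAddHom_tOp _
    rw [leftMul_single, evalAddHom_single, mul_assoc, ← hpow]
    exact evalAddHom_smulOp _ _

/-- The homomorphism from `k[t,σ,δ]` to `k_{σ,δ}((z))` which maps `t` to `z⁻¹`. -/
def toSkewSeries (δ : SkewDerivation σ) : OrePolynomial δ →+* SkewSeries δ where
  toFun p := evalAddHom δ p.toFinsupp
  map_one' := (evalAddHom_single 0 1).trans (by rw [map_one, pow_zero, mul_one])
  map_zero' := map_zero _
  map_add' _ _ := map_add _ _ _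
  map_mul' p q := evalAddHom_leftMul p.toFinsupp q.toFinsupp

theorem toSkewSeries_const (a : k) : toSkewSeries δ (const δ a) = SkewSeries.const δ a :=
  (evalAddHom_single 0 a).trans (by rw [pow_zero, mul_one])

/-- A vanishing value would be a left linear relation among powers of `z⁻¹`, which are independent
over the constants because `z⁻¹` has nonzero valuation. Nonzero polynomials thus become invertible,
as the passage to fractions requires. -/
theorem toSkewSeries_ne_zero {p : OrePolynomial δ} (hp : p ≠ 0) : toSkewSeries δ p ≠ 0 := by
  intro h
  refine hp (OrePolynomial.ext (Finsupp.ext fun n => ?_))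
  by_contra hn
  refine hn ((SkewSeries.addVal δ).coeff_eq_zero_of_sum_mul_pow_eq_zero (SkewSeries.const δ)
    (fun a ha => SkewSeries.addVal_const ha) SkewSeries.zInv_ne_zero ?_ p.toFinsupp.support
    p.toFinsupp ?_ n (Finsupp.mem_support_iff.mpr hn))
  · rw [SkewSeries.addVal_zInv]
    exact_mod_cast (by decide : (-1 : ℤ) ≠ 0)
  -- Evaluation unfolds to the sum over the support of the coefficients times powers of `z⁻¹`.
  · exact h

end OrePolynomial

/-! ### Embedding `k(t,σ,δ)` in `k_{σ,δ}((z))`. -/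

namespace SkewRationalFunction

variable {k : Type*} [DivisionRing k] {σ : k ≃+* k} {δ : SkewDerivation σ}

/-- The embedding of `k(t,σ,δ)` in `k_{σ,δ}((z))` which maps `t` to `z⁻¹`. -/
def toSkewSeries (δ : SkewDerivation σ) : SkewRationalFunction δ →+* SkewSeries δ :=
  OreLocalization.universalHom (OrePolynomial.toSkewSeries δ)
    -- The universal property of the Ore localization asks for a multiplicative choice of units
    -- lifting the images of the denominators.
    { toFun := fun s => Units.mk0 (OrePolynomial.toSkewSeries δ s)
        (OrePolynomial.toSkewSeries_ne_zero (nonZeroDivisors.ne_zero s.2))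
      map_one' := Units.ext (map_one (OrePolynomial.toSkewSeries δ))
      map_mul' := fun s t => Units.ext (map_mul (OrePolynomial.toSkewSeries δ) s.1 t.1) }
    fun _ => rfl

theorem toSkewSeries_const (a : k) :
    toSkewSeries δ (SkewRationalFunction.const δ a) = SkewSeries.const δ a :=
  (OreLocalization.universalHom_commutes _ _ _).trans (OrePolynomial.toSkewSeries_const a)

end SkewRationalFunction

end

theorem proposition2 {k : Type*} [DivisionRing k] (σ : k ≃+* k) (δ : SkewDerivation σ) :
    IsRegularExtension (SkewLaurentSeries.const σ) ∧
    IsRegularExtension (SkewSeries.const δ) ∧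
    IsRegularExtension (SkewRationalFunction.const δ) :=
  ⟨SkewLaurentSeries.isRegularExtension_const σ,
    -- The full series field is the case of the identity embedding.
    SkewSeries.isRegularExtension_of_ringHom _ (RingHom.id _) fun _ => rfl,
    SkewSeries.isRegularExtension_of_ringHom _ (SkewRationalFunction.toSkewSeries δ)
      SkewRationalFunction.toSkewSeries_const⟩
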